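/- Let $a^{+},a^{-}\in\mathbb{R}$ and let $q:\mathbb{R}\to\mathbb{R}$ be a measurable function with $$\int_{-\infty}^{0}|q(x)-a^{-}|\,dx+\int_{0}^{\infty}|q(x)-a^{+}|\,dx<\infty .$$ Let $l(y)=-y''+qy$, applied to functions $y:\mathbb{R}\to\mathbb{C}$ whose first derivative exists and is absolutely continuous on every compact interval; a solution of $l(y)=\mu y$ is such a function satisfying the equation almost everywhere. For such $y,z$ set $[y(x),z(x)]=i\bigl(y(x)\overline{z'(x)}-y'(x)\overline{z(x)}\bigr)$. Put $\mu_0=-\infty$, $\mu_1=\min\{a^+,a^-\}$, $\mu_2=\max\{a^+,a^-\}$, $\mu_3=+\infty$, and $\lambda_j^{\pm}(\mu)=(-1)^{j-1}\sqrt{\mu-a^{\pm}}$ for $\mu\in\mathbb{C}$, $j=1,2$ (principal value of the root). For real $\mu$ let $r^{\pm}(\mu)$ be half of the number of real roots $\lambda$ of $\lambda^2+a^{\pm}=\mu$, and let $r_k^{\pm}$ be the constant value of $r^{\pm}$ on $(\mu_k,\mu_{k+1})$, $k=0,1,2$. Then there are functions $y_j^{+}(x,\mu)$ ($x\in\mathbb{R}$,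 $\mu\in\mathbb{C}\setminus\{a^+\}$, $j=1,2$) and $y_j^{-}(x,\mu)$ ($x\in\mathbb{R}$, $\mu\in\mathbb{C}\setminus\{a^-\}$, $j=1,2$) such that, for every $\mu\in\mathbb{C}\setminus\{a^{+}\}$ (respectively $\mu\in\mathbb{C}\setminus\{a^{-}\}$), $y_1^{+}(\cdot,\mu),y_2^{+}(\cdot,\mu)$ (respectively $y_1^{-}(\cdot,\mu),y_2^{-}(\cdot,\mu)$) are linearly independent solutions of $l(y)=\mu y$ which, together with their derivatives $y_j^{\prime\pm}$ with respect to $x$, satisfy $$y_j^{\pm}(x,\mu)=e^{ix\lambda_j^{\pm}(\mu)}[1+o(1)],\qquad y_j^{\prime\pm}(x,\mu)=i\lambda_j^{\pm}(\mu)e^{ix\lambda_j^{\pm}(\mu)}[1+o(1)]$$ as $x\to+\infty$ (respectively as $x\to-\infty$). Moreover: 1. For every $\mu\in\mathbb{R}\setminus\{a^+,a^-\}$, all $j,k\in\{1,2\}$ and all $x\in\mathbb{R}$, the bracket $[y_j^{\pm}(x,\mu),y_k^{\pm}(x,\mu)]$ equals $2\lambda_j^{\pm}(\mu)$ if $\lambda_j^{\pm}(\mu)=\overline{\lambda_k^{\pm}(\mu)}$,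 and equals $0$ otherwise. 2. For each $k=0,1,2$, the functions $y_j^{+},y_j^{\prime+}$ ($1\le j\le 1+r_k^{+}$) and $y_j^{-},y_j^{\prime-}$ ($2-r_k^{-}\le j\le 2$) are continuous in the two variables $x\in\mathbb{R}$, $\mu\in(\mu_k,\mu_{k+1})$. 3. The functions $y_1^{+},y_1^{\prime+},y_2^{-},y_2^{\prime-}$ are differentiable in $\mu\in(\mu_0,\mu_1)$, and their derivatives with respect to $\mu$ are continuous in the two variables $x\in\mathbb{R}$, $\mu\in(\mu_0,\mu_1)$. 4. If in addition $$\int_{-\infty}^{0}(1-x)|q(x)-a^{-}|\,dx+\int_{0}^{\infty}(1+x)|q(x)-a^{+}|\,dx<\infty,$$ then for each $k=1,2$ the functions $y_j^{+},y_j^{\prime+}$ ($1\le j\le 1+r_k^{+}$) and $y_j^{-},y_j^{\prime-}$ ($2-r_k^{-}\le j\le 2$) are differentiable in $\mu\in(\mu_k,\mu_{k+1})$, and their derivatives with respect to $\mu$ are continuous in the two variables $x\in\mathbb{R}$, $\mu\in(\mu_k,\mu_{k+1})$. -/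

import Mathlib

open Filter Topology MeasureTheory Asymptotics

noncomputable section

namespace SturmLiouville

/-- `y` has a first derivative on all of `ℝ`, and that derivative is absolutely continuous on
every compact interval: the functions to which `l` is applicable. -/
def Applicable (y : ℝ → ℂ) : Prop :=
  Differentiable ℝ y ∧ ∀ α β : ℝ, AbsolutelyContinuousOnInterval (deriv y) α β

/-- The differential expression `l(y) = -y'' + q y`. (For applicable `y`, the second derivative
exists almost everywhere.) -/
def l (q : ℝ → ℝ) (y : ℝ → ℂ) (x : ℝ) : ℂ :=
  -deriv (deriv y) x + (q x : ℂ) * y x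

/-- `y` is a solution of `l(y) = μ y`: `l` is applicable to `y`, and the equation holds almost
everywhere. -/
def IsSolution (q : ℝ → ℝ) (μ : ℂ) (y : ℝ → ℂ) : Prop :=
  Applicable y ∧ ∀ᵐ x : ℝ, l q y x = μ * y x

/-- The bracket `[y(x), z(x)] = i (y(x) conj(z'(x)) - y'(x) conj(z(x)))`. -/
def bracket (y z : ℝ → ℂ) (x : ℝ) : ℂ :=
  Complex.I * (y x * starRingEnd ℂ (deriv z x) - deriv y x * starRingEnd ℂ (z x))

/-- `λ_j(μ) = (-1)^(j-1) √(μ - a)` with the principal value of the root. The index `j = 1, 2` is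
represented by the element `j - 1` of `Fin 2`. -/
def lam (a : ℝ) (j : Fin 2) (μ : ℂ) : ℂ :=
  (-1) ^ (j : ℕ) * Complex.sqrt (μ - (a : ℂ))

/-- Half of the number of real roots of the equation `λ² + a = μ`. -/
def r (a μ : ℝ) : ℚ :=
  (Set.ncard {t : ℝ | t ^ 2 + a = μ} : ℚ) / 2

/-- `μ₀ = -∞`, `μ₁ = min {a⁺, a⁻}`, `μ₂ = max {a⁺, a⁻}`, `μ₃ = ∞`. -/
def muPt (am ap : ℝ) : Fin 4 → EReal :=
  ![⊥, ((min ap am : ℝ) : EReal), ((max ap am : ℝ) : EReal), ⊤]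

/-- The open interval `(μ_k, μ_{k+1})` of real numbers, `k = 0, 1, 2`. -/
def muInterval (am ap : ℝ) (k : Fin 3) : Set ℝ :=
  {μ : ℝ | muPt am ap k.castSucc < (μ : EReal) ∧ (μ : EReal) < muPt am ap k.succ}

/-- `y(x, μ)` is continuous in the two variables `x ∈ ℝ`, `μ ∈ I`. -/
def JointlyContinuous (y : ℝ → ℂ → ℂ) (I : Set ℝ) : Prop :=
  ContinuousOn (fun p : ℝ × ℝ => y p.1 (p.2 : ℂ)) (Set.univ ×ˢ I)

/-- `y(x, μ)` is differentiable with respect to the real variable `μ ∈ I` (`I` open), and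
`∂y/∂μ` is continuous in the two variables `x ∈ ℝ`, `μ ∈ I`. -/
def ContDiffInParam (y : ℝ → ℂ → ℂ) (I : Set ℝ) : Prop :=
  (∀ x : ℝ, ∀ μ ∈ I, DifferentiableAt ℝ (fun m : ℝ => y x (m : ℂ)) μ) ∧
  ContinuousOn (fun p : ℝ × ℝ => deriv (fun m : ℝ => y p.1 (m : ℂ)) p.2) (Set.univ ×ˢ I)

/-- The derivative `y'(x, μ)` with respect to `x`. -/
def dx (y : ℝ → ℂ → ℂ) (x : ℝ) (μ : ℂ) : ℂ :=
  deriv (fun t : ℝ => y t μ) x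

/-- For fixed `μ`, the functions `y_1(·, μ)`, `y_2(·, μ)` are linearly independent solutions of
`l(y) = μ y` with `y_j(x, μ) = e^{i x λ_j(μ)} [1 + o(1)]` and
`y_j'(x, μ) = i λ_j(μ) e^{i x λ_j(μ)} [1 + o(1)]` along the filter `F` (`x → ∞` or `x → -∞`). -/
def IsJostPair (q : ℝ → ℝ) (a : ℝ) (F : Filter ℝ) (y : Fin 2 → ℝ → ℂ → ℂ) (μ : ℂ) : Prop :=
  (∀ j, IsSolution q μ (fun x => y j x μ)) ∧
  LinearIndependent ℂ (fun j : Fin 2 => fun x : ℝ => y j x μ) ∧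
  ∀ j,
    (fun x : ℝ => y j x μ) ~[F]
      (fun x : ℝ => Complex.exp (Complex.I * (x : ℂ) * lam a j μ)) ∧
    (fun x : ℝ => dx (y j) x μ) ~[F]
      (fun x : ℝ => Complex.I * lam a j μ * Complex.exp (Complex.I * (x : ℂ) * lam a j μ))

/-- `[y_j, y_k] = 2 λ_j(μ)` if `λ_j(μ) = conj(λ_k(μ))`, and `[y_j, y_k] = 0` otherwise, at every
point `x`. -/
def BracketRelations (a : ℝ) (y : Fin 2 → ℝ → ℂ → ℂ) (μ : ℂ) : Prop :=
  ∀ j k : Fin 2, ∀ x : ℝ,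
    (lam a j μ = starRingEnd ℂ (lam a k μ) →
      bracket (fun t => y j t μ) (fun t => y k t μ) x = 2 * lam a j μ) ∧
    (lam a j μ ≠ starRingEnd ℂ (lam a k μ) →
      bracket (fun t => y j t μ) (fun t => y k t μ) x = 0)

end SturmLiouville

end

open SturmLiouville

noncomputable section

namespace SturmLiouville

open Set
open scoped BoundedContinuousFunction

/-! Put `σ = iλ_j(μ)` and `V = q - a`, so that the equation is `y'' = (σ² + V) y`. If `Re σ ≤ 0`,
write `y = e^{σx} m`; the normalisation `m → 1` at `+∞` becomes the Volterra equation `m(x) = 1 +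
∫_x^∞ (e^{2σ(t-x)} - 1)/(2σ) V(t) m(t) dt`. Its kernel is bounded by `1/|σ|` and `V` is integrable
near `+∞`, so the iterates decay factorially and `1 - K` is invertible on every half-line `[X, ∞)`,
with no smallness assumption (`HasKernel.isUnit_one_sub`).

Regularity in `μ` comes from the operator: `K` depends on `σ` through the operators with kernel
`e^{2σs}`, which are norm continuous on `Re σ ≤ 0`. They are `C¹` on `Re σ ≤ -δ` if `2 s e^{-2δs}`
has a monotone majorant integrable against `|V|`. For `δ > 0` a constant suffices, which settles `μ
< a`; for `δ = 0` one needs the first moment of `V`, which is the extra hypothesis for `μ > a`.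
Inversion is smooth at units, so `m`, as a curve of bounded continuous functions, inherits the
regularity (`contDiffOn_jostB`).

If `Re σ > 0`, take the decaying solution `y` for `-σ` and any `z` with Wronskian `y z' - y' z =
2σ`. Then `(z/y)' = 2σ/y²`, and integrating gives `z ~ e^{σx}` (`IsJostSolution.of_wronskian`). The
multiple of `y` in `z` remains free; it is fixed by initial values that make the bracket of `z` with
itself vanish when that of `y` does (`IsJostSolution.exists_growing`).

For real `μ` the conjugate of a solution is a solution, so a bracket is a constant Wronskian, found
from its limit at `+∞`. Only the growing solution paired with itself escapes this argument, and
there the choice above is used. The end `-∞` follows by reflecting `x ↦ -x`, which exchanges the two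
indices. -/

/-! ### Primitives of locally integrable functions -/

/-- `f` is a primitive of the locally integrable function `g`. -/
structure IsPrimitive {𝕜 : Type*} [RCLike 𝕜] (f g : ℝ → 𝕜) : Prop where
  locInt : LocallyIntegrable g volume
  integral_eq : ∀ x y : ℝ, ∫ t in x..y, g t = f y - f x

theorem locallyIntegrable_intervalIntegrable {E : Type*} [NormedAddCommGroup E] {g : ℝ → E}
    (hg : LocallyIntegrable g volume) (x y : ℝ) : IntervalIntegrable g volume x y :=
  intervalIntegrable_iff.mpr <|
    (hg.integrableOn_isCompact isCompact_uIcc).mono_set uIoc_subset_uIcc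

theorem locallyIntegrable_of_intervalIntegrable {E : Type*} [NormedAddCommGroup E] {g : ℝ → E}
    (hg : ∀ x y : ℝ, IntervalIntegrable g volume x y) : LocallyIntegrable g volume := fun x =>
  ⟨Ioc (x - 1) (x + 1), Ioc_mem_nhds (by linarith) (by linarith),
    (intervalIntegrable_iff_integrableOn_Ioc_of_le (by linarith)).mp (hg _ _)⟩

namespace IsPrimitive

variable {𝕜 : Type*} [RCLike 𝕜] {f g f₁ g₁ f₂ g₂ : ℝ → 𝕜}

/-- The increments of `f` are dominated by those of the primitive of `‖g‖`, which is absolutely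
continuous. -/
theorem absolutelyContinuous (h : IsPrimitive f g) (α β : ℝ) :
    AbsolutelyContinuousOnInterval f α β := by
  have hn : LocallyIntegrable (fun t => ‖g t‖) volume := fun x => by
    obtain ⟨U, hU, hi⟩ := h.locInt x
    exact ⟨U, hU, hi.norm⟩
  have hG := (locallyIntegrable_intervalIntegrable hn α β).absolutelyContinuousOnInterval_intervalIntegral
    (c := α) (by simp)
  refine squeeze_zero (fun E => Finset.sum_nonneg fun i _ => dist_nonneg) (fun E => ?_) hG
  refine Finset.sum_le_sum fun i _ => ?_
  rw [dist_comm, dist_eq_norm, ← h.integral_eq, dist_comm, Real.dist_eq,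
    intervalIntegral.integral_interval_sub_left
      (locallyIntegrable_intervalIntegrable hn _ _) (locallyIntegrable_intervalIntegrable hn _ _)]
  exact intervalIntegral.norm_integral_le_abs_integral_norm

theorem ae_hasDerivAt (h : IsPrimitive f g) : ∀ᵐ x, HasDerivAt f (g x) x := by
  filter_upwards [LocallyIntegrable.ae_hasDerivAt_integral h.locInt] with x hx
  have : f = fun y => f 0 + ∫ t in (0 : ℝ)..y, g t := by
    funext y; rw [h.integral_eq]; ring
  rw [this]
  exact (hx 0).const_add _

theorem continuous (h : IsPrimitive f g) : Continuous f := by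
  rw [continuous_iff_continuousAt]
  intro x
  have := (h.absolutelyContinuous (x - 1) (x + 1)).continuousOn
  rw [uIcc_of_le (by linarith)] at this
  exact this.continuousAt (Icc_mem_nhds (by linarith) (by linarith))

/-- The difference between `f` and the integral of `g` is absolutely continuous with derivative zero
almost everywhere, hence constant. This gives product and conjugation rules for coefficients that
are merely integrable. -/
theorem of_ae (hac : ∀ α β, AbsolutelyContinuousOnInterval f α β)
    (hd : ∀ᵐ x, HasDerivAt f (g x) x) (hg : LocallyIntegrable g volume) : IsPrimitive f g := by
  refine ⟨hg, fun x y => ?_⟩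
  set G : ℝ → 𝕜 := fun z => ∫ t in x..z, g t with hG
  have hGp : IsPrimitive G g := ⟨hg, fun a b => by
    simp only [hG]
    rw [intervalIntegral.integral_interval_sub_left] <;>
      exact locallyIntegrable_intervalIntegrable hg _ _⟩
  obtain ⟨C, hC⟩ := ((hac x y).sub (hGp.absolutelyContinuous x y)).const_of_ae_hasDerivAt_zero (by
    filter_upwards [hd, hGp.ae_hasDerivAt] with z h1 h2 _
    simpa using h1.sub h2)
  have h1 := hC x (by simp)
  have h2 := hC y (by simp)
  simp only [Pi.sub_apply] at h1 h2
  have h3 : G x = 0 := by simp [hG]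
  change G y = _
  rw [h3, sub_zero] at h1
  rw [h1, ← h2]; ring

theorem mul (h₁ : IsPrimitive f₁ g₁) (h₂ : IsPrimitive f₂ g₂) :
    IsPrimitive (fun x => f₁ x * f₂ x) (fun x => g₁ x * f₂ x + f₁ x * g₂ x) := by
  refine of_ae (fun α β => ?_) ?_ ?_
  · exact (h₁.absolutelyContinuous α β).smul (h₂.absolutelyContinuous α β)
  · filter_upwards [h₁.ae_hasDerivAt, h₂.ae_hasDerivAt] with x hx hy using hx.mul hy
  · refine LocallyIntegrable.add ?_ ?_
    · have := h₁.locInt.smul_continuous (𝕜 := 𝕜) h₂.continuous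
      simpa [mul_comm] using this
    · have := h₂.locInt.smul_continuous (𝕜 := 𝕜) h₁.continuous
      simpa [mul_comm] using this

theorem add (h₁ : IsPrimitive f₁ g₁) (h₂ : IsPrimitive f₂ g₂) :
    IsPrimitive (fun x => f₁ x + f₂ x) (fun x => g₁ x + g₂ x) := by
  refine ⟨h₁.locInt.add h₂.locInt, fun x y => ?_⟩
  rw [intervalIntegral.integral_add (locallyIntegrable_intervalIntegrable h₁.locInt _ _)
    (locallyIntegrable_intervalIntegrable h₂.locInt _ _), h₁.integral_eq, h₂.integral_eq]
  ring

theorem const_mul (c : 𝕜) (h : IsPrimitive f g) :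
    IsPrimitive (fun x => c * f x) (fun x => c * g x) := by
  refine ⟨h.locInt.smul c, fun x y => ?_⟩
  rw [intervalIntegral.integral_const_mul, h.integral_eq]
  ring

theorem neg (h : IsPrimitive f g) : IsPrimitive (fun x => - f x) (fun x => - g x) := by
  simpa using h.const_mul (-1)

theorem sub (h₁ : IsPrimitive f₁ g₁) (h₂ : IsPrimitive f₂ g₂) :
    IsPrimitive (fun x => f₁ x - f₂ x) (fun x => g₁ x - g₂ x) := by
  simpa [sub_eq_add_neg] using h₁.add h₂.neg

theorem of_hasDerivAt (h : ∀ x, HasDerivAt f (g x) x) (hg : Continuous g) : IsPrimitive f g :=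
  ⟨hg.locallyIntegrable, fun _ _ => intervalIntegral.integral_eq_sub_of_hasDerivAt
    (fun t _ => h t) (hg.intervalIntegrable _ _)⟩

theorem hasDerivAt (h : IsPrimitive f g) (hg : Continuous g) (x : ℝ) : HasDerivAt f (g x) x := by
  have : f = fun y => f 0 + ∫ t in (0 : ℝ)..y, g t := by
    funext y; rw [h.integral_eq]; ring
  rw [this]
  exact (intervalIntegral.integral_hasDerivAt_right (hg.intervalIntegrable _ _)
    hg.stronglyMeasurable.stronglyMeasurableAtFilter hg.continuousAt).const_add _

theorem congr_ae (h : IsPrimitive f g) (hg : g =ᵐ[volume] g₁) : IsPrimitive f g₁ := by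
  refine ⟨h.locInt.congr hg, fun x y => ?_⟩
  rw [← h.integral_eq x y]
  exact intervalIntegral.integral_congr_ae (by filter_upwards [hg] with t ht _ using ht.symm)

theorem congr (h : IsPrimitive f g) (hf : ∀ x, f x = f₁ x) (hg : ∀ x, g x = g₁ x) :
    IsPrimitive f₁ g₁ := by
  rwa [← funext hf, ← funext hg]

theorem eq_of_zero (h : IsPrimitive f (fun _ => 0)) (x y : ℝ) : f x = f y := by
  have := h.integral_eq x y
  simp only [intervalIntegral.integral_zero] at this
  exact (sub_eq_zero.mp this.symm).symm

theorem comp_neg (h : IsPrimitive f g) :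
    IsPrimitive (fun x => f (-x)) (fun x => - g (-x)) := by
  refine ⟨locallyIntegrable_of_intervalIntegrable fun x y => ?_, fun x y => ?_⟩
  · have := (locallyIntegrable_intervalIntegrable h.locInt (-x) (-y)).comp_sub_left 0
    exact (by simpa using this : IntervalIntegrable (fun x => g (-x)) volume x y).neg
  · rw [intervalIntegral.integral_neg, intervalIntegral.integral_comp_neg, h.integral_eq]
    ring

theorem conj (h : IsPrimitive f g) :
    IsPrimitive (fun x => starRingEnd 𝕜 (f x)) (fun x => starRingEnd 𝕜 (g x)) := by
  refine of_ae (fun α β => ?_) ?_ fun x => ?_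
  · refine squeeze_zero (fun E => Finset.sum_nonneg fun i _ => dist_nonneg) (fun E => ?_)
      (h.absolutelyContinuous α β)
    refine Finset.sum_le_sum fun i _ => ?_
    rw [dist_eq_norm, dist_eq_norm, ← map_sub, RCLike.norm_conj]
  · filter_upwards [h.ae_hasDerivAt] with x hx using hx.star
  · obtain ⟨U, hU, hi⟩ := h.locInt x
    exact ⟨U, hU, ((RCLike.conjCLE (K := 𝕜)).toContinuousLinearMap.integrable_comp hi).congr
      (ae_of_all _ fun t => by simp)⟩

theorem tail {g : ℝ → 𝕜} (hg : ∀ X, IntegrableOn g (Ioi X) volume) :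
    IsPrimitive (fun x => ∫ t in Ioi x, g t) (fun x => - g x) := by
  refine ⟨locallyIntegrable_of_intervalIntegrable fun x y => ?_, fun x y => ?_⟩
  · refine IntervalIntegrable.neg (intervalIntegrable_iff.mpr ?_)
    exact (hg (min x y)).mono_set fun t ht => ht.1
  · rw [intervalIntegral.integral_neg, ← intervalIntegral.integral_Ioi_sub_Ioi' (hg x) (hg y)]
    ring

theorem tendsto_tail {g : ℝ → 𝕜} (hg : ∀ X, IntegrableOn g (Ioi X) volume) :
    Tendsto (fun x => ∫ t in Ioi x, g t) atTop (𝓝 0) := by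
  have h1 := intervalIntegral_tendsto_integral_Ioi 0 (hg 0) tendsto_id
  have h2 : (fun x => ∫ t in Ioi x, g t) =
      fun x => (∫ t in Ioi (0 : ℝ), g t) - ∫ t in (0 : ℝ)..x, g t := by
    funext x
    rw [← intervalIntegral.integral_Ioi_sub_Ioi' (hg 0) (hg x)]
    ring
  rw [h2]
  simpa using h1.const_sub (∫ t in Ioi (0 : ℝ), g t)

end IsPrimitive

/-! ### Volterra operators on a half-line -/

/-- With `Q` the tail integral of `v`, `Q' = -v`, so `v Qⁿ` is the derivative of `-Q^{n+1}/(n+1)`.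
The factor `1/(n+1)` is the source of the factorial in the Volterra iteration. -/
theorem integral_tail_pow {v : ℝ → ℝ} (hv : ∀ X, IntegrableOn v (Ioi X) volume)
    (h0 : ∀ x, 0 ≤ v x) (n : ℕ) (x : ℝ) :
    IntegrableOn (fun t => v t * (∫ s in Ioi t, v s) ^ n) (Ioi x) volume ∧
    ∫ t in Ioi x, v t * (∫ s in Ioi t, v s) ^ n = (∫ s in Ioi x, v s) ^ (n + 1) / (n + 1) := by
  have hQ := IsPrimitive.tail hv
  set Q : ℝ → ℝ := fun t => ∫ s in Ioi t, v s with hQdef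
  have hpow : ∀ n : ℕ, IsPrimitive (fun t => Q t ^ (n + 1))
      (fun t => -((n + 1) * (v t * Q t ^ n))) := by
    intro n
    induction n with
    | zero => exact hQ.congr (fun t => by ring) (fun t => by simp)
    | succ n ih =>
      refine (ih.mul hQ).congr (fun t => by ring) (fun t => ?_)
      push_cast; ring
  have hp := ((hpow n).const_mul (-(1 / ((n : ℝ) + 1)))).congr (f₁ := fun t => -(Q t ^ (n + 1) / (n + 1)))
    (g₁ := fun t => v t * Q t ^ n) (fun t => by ring) (fun t => by field_simp)
  have hQ0 : ∀ t, 0 ≤ Q t := fun t => integral_nonneg fun s => h0 s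
  have htend : Tendsto (fun t => ∫ s in x..t, v s * Q s ^ n) atTop (𝓝 (Q x ^ (n + 1) / (n + 1))) := by
    have h1 : Tendsto Q atTop (𝓝 0) := IsPrimitive.tendsto_tail hv
    have h2 := (((h1.pow (n + 1)).div_const ((n : ℝ) + 1)).const_sub (Q x ^ (n + 1) / (n + 1)))
    simp only [ne_eq, Nat.add_eq_zero_iff, one_ne_zero, and_false, not_false_eq_true, zero_pow,
      zero_div, sub_zero] at h2
    refine h2.congr fun t => ?_
    rw [hp.integral_eq]; ring
  have hint : IntegrableOn (fun t => v t * Q t ^ n) (Ioi x) volume := by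
    refine integrableOn_Ioi_of_intervalIntegral_norm_tendsto (Q x ^ (n + 1) / (n + 1)) x
      (b := id) (l := atTop) (fun i => ?_) tendsto_id ?_
    · exact (hp.locInt.integrableOn_isCompact isCompact_Icc).mono_set Ioc_subset_Icc_self
    · refine htend.congr fun t => ?_
      refine intervalIntegral.integral_congr fun s _ => ?_
      exact (Real.norm_of_nonneg (mul_nonneg (h0 s) (pow_nonneg (hQ0 s) n))).symm
  exact ⟨hint, tendsto_nhds_unique
    (intervalIntegral_tendsto_integral_Ioi x hint tendsto_id) htend⟩

/-- The Volterra integral over `(x, ∞)` with difference kernel `k` and weight `V`. -/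
def volterra (V k g : ℝ → ℂ) (x : ℝ) : ℂ :=
  ∫ t in Ioi x, k (t - x) * V t * g t

/-- The kernel `k` is dominated by the monotone function `h`, which is integrable against `|V|`
when started at `X`. -/
structure KernelBound (V : ℝ → ℂ) (X : ℝ) (k : ℝ → ℂ) (h : ℝ → ℝ) : Prop where
  cont : Continuous k
  mono : MonotoneOn h (Ici 0)
  le : ∀ s, 0 ≤ s → ‖k s‖ ≤ h s
  int : IntegrableOn (fun t => h (t - X) * ‖V t‖) (Ioi X) volume

/-- The operator `A` on bounded continuous functions is the Volterra operator with kernel `k` on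
`[X, ∞)`; to the left of `X` its values are constant. -/
def HasKernel (V : ℝ → ℂ) (X : ℝ) (A : (ℝ →ᵇ ℂ) →L[ℂ] (ℝ →ᵇ ℂ)) (k : ℝ → ℂ) : Prop :=
  ∀ (g : ℝ →ᵇ ℂ) (x : ℝ), A g x = volterra V k g (max x X)

section

variable {V k k₁ k₂ : ℝ → ℂ} {X x : ℝ} {h h₁ h₂ : ℝ → ℝ}

/-- Since `t - x ≤ t - X`, monotonicity of `h` gives a bound independent of `x`; every domination
below rests on it. -/
theorem KernelBound.norm_le (hk : KernelBound V X k h) (hx : X ≤ x) {t : ℝ} (ht : x < t) {g : ℝ → ℂ}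
    {M : ℝ} (hg : ‖g t‖ ≤ M) :
    ‖k (t - x) * V t * g t‖ ≤ h (t - X) * ‖V t‖ * M := by
  have h1 : ‖k (t - x)‖ ≤ h (t - X) :=
    (hk.le _ (by linarith)).trans (hk.mono (mem_Ici.2 (by linarith)) (mem_Ici.2 (by linarith))
      (by linarith))
  rw [norm_mul, norm_mul]
  have h0 : 0 ≤ h (t - X) := (norm_nonneg _).trans h1
  gcongr

theorem KernelBound.integrable (hV : ∀ X, IntegrableOn V (Ioi X) volume)
    (hk : KernelBound V X k h) (hx : X ≤ x) {g : ℝ → ℂ} (hgc : Continuous g) {M : ℝ}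
    (hg : ∀ t, X < t → ‖g t‖ ≤ M) :
    IntegrableOn (fun t => k (t - x) * V t * g t) (Ioi x) volume := by
  refine Integrable.mono' ((hk.int.mono_set (Ioi_subset_Ioi hx)).mul_const M) ?_ ?_
  · exact (((hk.cont.comp (continuous_id.sub continuous_const)).aestronglyMeasurable).mul
      (hV x).aestronglyMeasurable).mul hgc.aestronglyMeasurable
  · exact (ae_restrict_iff' measurableSet_Ioi).2 (ae_of_all _ fun t ht =>
      hk.norm_le hx ht (hg t (hx.trans_lt ht)))

theorem KernelBound.norm_volterra_le (hk : KernelBound V X k h) (hx : X ≤ x) {g : ℝ → ℂ} {M : ℝ}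
    (hg : ∀ t, X < t → ‖g t‖ ≤ M) :
    ‖volterra V k g x‖ ≤ (∫ t in Ioi x, h (t - X) * ‖V t‖) * M := by
  rw [← integral_mul_const]
  refine norm_integral_le_of_norm_le ((hk.int.mono_set (Ioi_subset_Ioi hx)).mul_const M) ?_
  exact (ae_restrict_iff' measurableSet_Ioi).2 (ae_of_all _ fun t ht =>
      hk.norm_le hx ht (hg t (hx.trans_lt ht)))

theorem KernelBound.integral_mono (hk : KernelBound V X k h) (hx : X ≤ x) :
    (∫ t in Ioi x, h (t - X) * ‖V t‖) ≤ ∫ t in Ioi X, h (t - X) * ‖V t‖ := by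
  refine setIntegral_mono_set hk.int ?_ (Ioi_subset_Ioi hx).eventuallyLE
  refine (ae_restrict_iff' measurableSet_Ioi).2 (ae_of_all _ fun t ht => ?_)
  exact mul_nonneg ((norm_nonneg _).trans (hk.le _ (sub_nonneg.2 (le_of_lt ht)))) (norm_nonneg _)

theorem KernelBound.integral_nonneg (hk : KernelBound V X k h) :
    0 ≤ ∫ t in Ioi X, h (t - X) * ‖V t‖ := by
  refine setIntegral_nonneg measurableSet_Ioi fun t ht => ?_
  exact mul_nonneg ((norm_nonneg _).trans (hk.le _ (sub_nonneg.2 (le_of_lt ht)))) (norm_nonneg _)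

/-- Dominated convergence, after the moving endpoint has been put into an indicator on the fixed
domain `(X, ∞)`. The integrand is continuous in `x` except at the null point `t = max x X`. -/
theorem KernelBound.continuous_volterra (hV : ∀ X, IntegrableOn V (Ioi X) volume)
    (hk : KernelBound V X k h) {g : ℝ → ℂ} (hgc : Continuous g) {M : ℝ}
    (hg : ∀ t, X < t → ‖g t‖ ≤ M) :
    Continuous (fun x => volterra V k g (max x X)) := by
  have key : ∀ x, volterra V k g (max x X) = ∫ t in Ioi X,
      (Ioi (max x X)).indicator (fun t => k (t - max x X) * V t * g t) t := by
    intro x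
    rw [setIntegral_indicator measurableSet_Ioi, Ioi_inter_Ioi, sup_eq_right.2 (le_max_right x X)]
    rfl
  simp_rw [key]
  rw [continuous_iff_continuousAt]
  intro x
  refine continuousAt_of_dominated (bound := fun t => h (t - X) * ‖V t‖ * M) ?_ ?_
    (hk.int.mul_const M) ?_
  · refine Eventually.of_forall fun y => ?_
    refine AEStronglyMeasurable.indicator ?_ measurableSet_Ioi
    exact (((hk.cont.comp (continuous_id.sub continuous_const)).aestronglyMeasurable).mul
      (hV X).aestronglyMeasurable).mul hgc.aestronglyMeasurable
  · refine Eventually.of_forall fun y => ?_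
    refine (ae_restrict_iff' measurableSet_Ioi).2 (ae_of_all _ fun t ht => ?_)
    have h0 : 0 ≤ h (t - X) := (norm_nonneg _).trans (hk.le _ (sub_nonneg.2 (le_of_lt ht)))
    have hM : 0 ≤ M := (norm_nonneg _).trans (hg t ht)
    by_cases hty : t ∈ Ioi (max y X)
    · rw [indicator_of_mem hty]
      exact hk.norm_le (le_max_right _ _) hty (hg t ht)
    · rw [indicator_of_notMem hty, norm_zero]
      positivity
  · refine ae_restrict_of_ae ?_
    have : ∀ᵐ t : ℝ, t ≠ max x X := by simp [ae_iff, measure_singleton]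
    filter_upwards [this] with t ht
    have hc : ContinuousAt (fun y : ℝ => max y X) x := by fun_prop
    rcases lt_or_gt_of_ne ht with hlt | hgt
    · refine continuousAt_const.congr (f := fun _ => (0 : ℂ)) ?_
      filter_upwards [hc.eventually (lt_mem_nhds hlt)] with y hy
      rw [indicator_of_notMem (by simpa using (not_lt.2 hy.le : ¬ max y X < t))]
    · have h2 : ContinuousAt (fun y => k (t - max y X) * V t * g t) x := by
        have := hk.cont
        fun_prop
      refine h2.congr ?_
      filter_upwards [hc.eventually (gt_mem_nhds hgt)] with y hy
      rw [indicator_of_mem (by exact hy)]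

theorem KernelBound.exists_hasKernel (hV : ∀ X, IntegrableOn V (Ioi X) volume)
    (hk : KernelBound V X k h) : ∃ A, HasKernel V X A k := by
  have hb : ∀ (g : ℝ →ᵇ ℂ) (x : ℝ), ‖volterra V k g (max x X)‖ ≤
      (∫ t in Ioi X, h (t - X) * ‖V t‖) * ‖g‖ := fun g x =>
    (hk.norm_volterra_le (le_max_right _ _) fun t _ => g.norm_coe_le_norm t).trans
      (mul_le_mul_of_nonneg_right (hk.integral_mono (le_max_right _ _)) (norm_nonneg g))
  have hint : ∀ (g : ℝ →ᵇ ℂ) (x : ℝ),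
      IntegrableOn (fun t => k (t - max x X) * V t * g t) (Ioi (max x X)) volume := fun g x =>
    hk.integrable hV (le_max_right _ _) g.continuous fun t _ => g.norm_coe_le_norm t
  let L : (ℝ →ᵇ ℂ) →ₗ[ℂ] (ℝ →ᵇ ℂ) :=
    { toFun := fun g => BoundedContinuousFunction.ofNormedAddCommGroup
        (fun x => volterra V k g (max x X))
        (hk.continuous_volterra hV g.continuous fun t _ => g.norm_coe_le_norm t) _ (hb g)
      map_add' := fun g₁ g₂ => by
        ext x
        simp only [volterra, BoundedContinuousFunction.coe_ofNormedAddCommGroup,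
          BoundedContinuousFunction.coe_add, Pi.add_apply]
        rw [← integral_add (hint g₁ x) (hint g₂ x)]
        exact integral_congr_ae (ae_of_all _ fun t => by simp only; ring)
      map_smul' := fun c g => by
        ext x
        simp only [volterra, BoundedContinuousFunction.coe_ofNormedAddCommGroup,
          BoundedContinuousFunction.coe_smul, RingHom.id_apply, smul_eq_mul]
        rw [← integral_const_mul]
        exact integral_congr_ae (ae_of_all _ fun t => by simp only; ring) }
  refine ⟨L.mkContinuous (∫ t in Ioi X, h (t - X) * ‖V t‖) fun g => ?_, fun g x => rfl⟩
  exact (BoundedContinuousFunction.norm_le (mul_nonneg hk.integral_nonneg (norm_nonneg g))).2 (hb g)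

theorem HasKernel.opNorm_le {A : (ℝ →ᵇ ℂ) →L[ℂ] (ℝ →ᵇ ℂ)} (hA : HasKernel V X A k)
    (hk : KernelBound V X k h) : ‖A‖ ≤ ∫ t in Ioi X, h (t - X) * ‖V t‖ := by
  refine A.opNorm_le_bound hk.integral_nonneg fun g => ?_
  refine (BoundedContinuousFunction.norm_le (mul_nonneg hk.integral_nonneg (norm_nonneg g))).2
    fun x => ?_
  rw [hA]
  exact (hk.norm_volterra_le (le_max_right _ _) fun t _ =>
    g.norm_coe_le_norm t).trans
      (mul_le_mul_of_nonneg_right (hk.integral_mono (le_max_right _ _)) (norm_nonneg g))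

/-- With `HasKernel.smul`, this turns norm estimates for increments of operators into pointwise
estimates for their kernels. -/
theorem HasKernel.sub (hV : ∀ X, IntegrableOn V (Ioi X) volume)
    {A₁ A₂ : (ℝ →ᵇ ℂ) →L[ℂ] (ℝ →ᵇ ℂ)} (hA₁ : HasKernel V X A₁ k₁) (hA₂ : HasKernel V X A₂ k₂)
    (hk₁ : KernelBound V X k₁ h₁) (hk₂ : KernelBound V X k₂ h₂) :
    HasKernel V X (A₁ - A₂) (fun s => k₁ s - k₂ s) := by
  intro g x
  simp only [FunLike.coe_sub, Pi.sub_apply, BoundedContinuousFunction.coe_sub]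
  rw [hA₁, hA₂, volterra, volterra, volterra, ← integral_sub
    (hk₁.integrable hV (le_max_right _ _) g.continuous fun t _ => g.norm_coe_le_norm t)
    (hk₂.integrable hV (le_max_right _ _) g.continuous fun t _ => g.norm_coe_le_norm t)]
  exact integral_congr_ae (ae_of_all _ fun t => by simp only; ring)

theorem HasKernel.smul {A : (ℝ →ᵇ ℂ) →L[ℂ] (ℝ →ᵇ ℂ)} (hA : HasKernel V X A k) (c : ℂ) :
    HasKernel V X (c • A) (fun s => c * k s) := by
  intro g x
  simp only [FunLike.coe_smul, Pi.smul_apply, BoundedContinuousFunction.coe_smul,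
    smul_eq_mul]
  rw [hA, volterra, volterra, ← integral_const_mul]
  exact integral_congr_ae (ae_of_all _ fun t => by simp only; ring)

end

/-- If the kernel is bounded, the powers of a Volterra operator decay factorially. -/
theorem HasKernel.isUnit_one_sub {V k : ℝ → ℂ} {X C : ℝ} {A : (ℝ →ᵇ ℂ) →L[ℂ] (ℝ →ᵇ ℂ)}
    (hV : ∀ X, IntegrableOn V (Ioi X) volume) (hA : HasKernel V X A k)
    (hk : ∀ s, 0 ≤ s → ‖k s‖ ≤ C) : IsUnit (1 - A) := by
  have hC : 0 ≤ C := (norm_nonneg _).trans (hk 0 le_rfl)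
  have hv : ∀ X, IntegrableOn (fun t => ‖V t‖) (Ioi X) volume := fun X => (hV X).norm
  set Q : ℝ → ℝ := fun x => ∫ s in Ioi x, ‖V s‖ with hQ
  have hQ0 : ∀ t, 0 ≤ Q t := fun t => integral_nonneg fun s => norm_nonneg _
  have hbound : ∀ (n : ℕ) (g : ℝ →ᵇ ℂ) (x : ℝ), X ≤ x →
      ‖(A ^ n) g x‖ ≤ C ^ n * Q x ^ n / n.factorial * ‖g‖ := by
    intro n g
    induction n with
    | zero => intro x _; simpa using g.norm_coe_le_norm x
    | succ n ih =>
      intro x hx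
      obtain ⟨hi, he⟩ := integral_tail_pow hv (fun _ => norm_nonneg _) n x
      rw [pow_succ', mul_apply_eq_comp, hA, max_eq_left hx, volterra]
      refine (norm_integral_le_of_norm_le
        (hi.const_mul (C ^ (n + 1) / n.factorial * ‖g‖)) ?_).trans (le_of_eq ?_)
      · refine (ae_restrict_iff' measurableSet_Ioi).2 (ae_of_all _ fun t ht => ?_)
        have h1 := hk (t - x) (sub_nonneg.2 (le_of_lt ht))
        have h2 := ih t (hx.trans (le_of_lt ht))
        rw [norm_mul, norm_mul]
        calc ‖k (t - x)‖ * ‖V t‖ * ‖(A ^ n) g t‖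
            ≤ C * ‖V t‖ * (C ^ n * Q t ^ n / n.factorial * ‖g‖) := by gcongr
          _ = _ := by simp only [hQ]; ring
      · rw [integral_const_mul, he, Nat.factorial_succ]
        push_cast
        field_simp
        ring
  have hmono : ∀ x, X ≤ x → Q x ≤ Q X := fun x hx =>
    setIntegral_mono_set (hv X) (ae_of_all _ fun _ => norm_nonneg _)
      (Ioi_subset_Ioi hx).eventuallyLE
  -- Only positive powers of `A` have values that are constant to the left of `X`, hence the
  -- exponent `n + 1`.
  have hconst : ∀ (n : ℕ) (g : ℝ →ᵇ ℂ) (x : ℝ),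
      (A ^ (n + 1)) g x = (A ^ (n + 1)) g (max x X) := by
    intro n g x
    rw [pow_succ', mul_apply_eq_comp, hA, hA, max_eq_left (le_max_right x X)]
  have hnorm : ∀ n : ℕ, ‖A ^ (n + 1)‖ ≤ (C * Q X) ^ (n + 1) / (n + 1).factorial := by
    intro n
    have hnn : 0 ≤ (C * Q X) ^ (n + 1) / ((n + 1).factorial : ℝ) := by
      have := hQ0 X
      positivity
    refine (A ^ (n + 1)).opNorm_le_bound hnn fun g => ?_
    refine (BoundedContinuousFunction.norm_le (mul_nonneg hnn (norm_nonneg g))).2 fun x => ?_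
    rw [hconst]
    refine (hbound (n + 1) g _ (le_max_right x X)).trans ?_
    rw [mul_pow]
    have := hmono _ (le_max_right x X)
    have := hQ0 (max x X)
    gcongr
  -- One power of norm less than one is enough: `1 - A^{n+1}` is then a unit, and `1 - A` is a
  -- factor of it that commutes with the complementary geometric sum.
  obtain ⟨n, hn⟩ : ∃ n : ℕ, ‖A ^ (n + 1)‖ < 1 := by
    have h1 := (tendsto_add_atTop_iff_nat 1).2
      (FloorSemiring.tendsto_pow_div_factorial_atTop (C * Q X))
    obtain ⟨n, hn⟩ := (h1.eventually (gt_mem_nhds one_pos)).exists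
    exact ⟨n, (hnorm n).trans_lt hn⟩
  have hu : IsUnit (1 - A ^ (n + 1)) :=
    isUnit_one_sub_of_norm_lt_one (R := (ℝ →ᵇ ℂ) →L[ℂ] (ℝ →ᵇ ℂ)) hn
  rw [← mul_neg_geom_sum] at hu
  have hcomm : Commute (1 - A) (∑ i ∈ Finset.range (n + 1), A ^ i) :=
    Commute.sum_right _ _ _ fun i _ => ((Commute.one_left A).sub_left (Commute.refl A)).pow_right i
  exact (hcomm.isUnit_mul_iff.1 hu).1

/-! ### Exponential kernels and their dependence on `σ` -/

/-- The kernel `e^{2σs}`. -/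
def expKernel (σ : ℂ) (s : ℝ) : ℂ := Complex.exp (2 * σ * s)

/-- The derivative of `e^{2σs}` with respect to `σ`. -/
def dexpKernel (σ : ℂ) (s : ℝ) : ℂ := 2 * s * Complex.exp (2 * σ * s)

theorem continuous_expKernel (σ : ℂ) : Continuous (expKernel σ) := by
  unfold expKernel; fun_prop

theorem continuous_dexpKernel (σ : ℂ) : Continuous (dexpKernel σ) := by
  unfold dexpKernel; fun_prop

theorem hasDerivAt_expKernel (s : ℝ) (z : ℂ) :
    HasDerivAt (fun z => expKernel z s) (dexpKernel z s) z := by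
  have := (((hasDerivAt_id z).const_mul 2).mul_const (s : ℂ)).cexp
  refine this.congr_deriv ?_
  simp only [dexpKernel, id, mul_one]
  ring

section

variable {δ s : ℝ} {σ τ : ℂ}

theorem norm_expKernel_le (hs : 0 ≤ s) (hσ : σ.re ≤ -δ) :
    ‖expKernel σ s‖ ≤ Real.exp (-(2 * δ * s)) := by
  rw [expKernel, Complex.norm_exp]
  refine Real.exp_le_exp.2 ?_
  have : (2 * σ * (s : ℂ)).re = 2 * σ.re * s := by simp [Complex.mul_re]
  rw [this]
  nlinarith

theorem norm_expKernel_le_one (hs : 0 ≤ s) (hσ : σ.re ≤ 0) : ‖expKernel σ s‖ ≤ 1 := by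
  simpa using norm_expKernel_le (δ := 0) hs (by simpa using hσ)

theorem norm_dexpKernel_le (hs : 0 ≤ s) (hσ : σ.re ≤ -δ) :
    ‖dexpKernel σ s‖ ≤ 2 * s * Real.exp (-(2 * δ * s)) := by
  have h := norm_expKernel_le hs hσ
  rw [dexpKernel, norm_mul]
  have h2 : ‖(2 * (s : ℂ))‖ = 2 * s := by
    rw [norm_mul, Complex.norm_real, Real.norm_of_nonneg hs]; simp
  rw [h2]
  exact mul_le_mul_of_nonneg_left h (by positivity)

/-- The bound `2` is the triangle inequality, the other is the mean value inequality on the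
half-plane. Keeping the minimum makes the increment small pointwise yet dominated, so no extra power
of `s` has to be integrable. -/
theorem norm_expKernel_sub_le (hs : 0 ≤ s) (hσ : σ.re ≤ -δ) (hτ : τ.re ≤ -δ) :
    ‖expKernel τ s - expKernel σ s‖ ≤
      Real.exp (-(2 * δ * s)) * min 2 (2 * s * ‖τ - σ‖) := by
  rw [mul_min_of_nonneg _ _ (Real.exp_pos _).le]
  refine le_min ?_ ?_
  · refine (norm_sub_le _ _).trans ?_
    linarith [norm_expKernel_le hs hσ, norm_expKernel_le hs hτ]
  · have hc : Convex ℝ {z : ℂ | z.re ≤ -δ} := convex_halfSpace_re_le (-δ)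
    have := hc.norm_image_sub_le_of_norm_hasDerivWithin_le (f := fun z => expKernel z s)
      (f' := fun z => dexpKernel z s) (fun z _ => (hasDerivAt_expKernel s z).hasDerivWithinAt)
      (fun z hz => norm_dexpKernel_le hs hz) hσ hτ
    refine this.trans (le_of_eq ?_)
    ring

/-- Mean value inequality for `z ↦ e^{2zs} - z · 2s e^{2σs}`, whose derivative is `2s(e^{2zs} -
e^{2σs})`. A second-order Taylor bound would cost `s²`, that is, a second moment of `V`; here a
single factor `s` stands outside the minimum. -/
theorem norm_expKernel_taylor_le (hs : 0 ≤ s) (hσ : σ.re ≤ -δ) (hτ : τ.re ≤ -δ) :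
    ‖expKernel τ s - expKernel σ s - (τ - σ) * dexpKernel σ s‖ ≤
      ‖τ - σ‖ * (2 * s * Real.exp (-(2 * δ * s)) * min 2 (2 * s * ‖τ - σ‖)) := by
  have hc : Convex ℝ ({z : ℂ | z.re ≤ -δ} ∩ Metric.closedBall σ ‖τ - σ‖) :=
    (convex_halfSpace_re_le (-δ)).inter (convex_closedBall _ _)
  have hd : ∀ z, HasDerivAt (fun z => expKernel z s - z * dexpKernel σ s)
      (dexpKernel z s - dexpKernel σ s) z := fun z =>
    ((hasDerivAt_expKernel s z).sub ((hasDerivAt_id z).mul_const (dexpKernel σ s))).congr_deriv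
      (by simp)
  have := hc.norm_image_sub_le_of_norm_hasDerivWithin_le
    (C := 2 * s * Real.exp (-(2 * δ * s)) * min 2 (2 * s * ‖τ - σ‖))
    (fun z _ => (hd z).hasDerivWithinAt) (fun z hz => ?_)
    ⟨hσ, by simp⟩ ⟨hτ, by simp [dist_eq_norm]⟩
  · refine (le_of_eq ?_).trans (this.trans (le_of_eq (by ring)))
    congr 1
    ring
  · have h1 : dexpKernel z s - dexpKernel σ s = 2 * s * (expKernel z s - expKernel σ s) := by
      simp only [dexpKernel, expKernel]; ring
    have h2 : ‖(2 * (s : ℂ))‖ = 2 * s := by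
      rw [norm_mul, Complex.norm_real, Real.norm_of_nonneg hs]; simp
    have h3 : ‖z - σ‖ ≤ ‖τ - σ‖ := by simpa [dist_eq_norm] using hz.2
    rw [h1, norm_mul, h2]
    calc 2 * s * ‖expKernel z s - expKernel σ s‖
        ≤ 2 * s * (Real.exp (-(2 * δ * s)) * min 2 (2 * s * ‖z - σ‖)) := by
          gcongr; exact norm_expKernel_sub_le hs hσ hz.1
      _ ≤ 2 * s * (Real.exp (-(2 * δ * s)) * min 2 (2 * s * ‖τ - σ‖)) := by gcongr
      _ = _ := by ring

end

/-- The Volterra operator with a given kernel (zero if the kernel is not admissible). -/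
def kernelOp (V : ℝ → ℂ) (X : ℝ) (k : ℝ → ℂ) : (ℝ →ᵇ ℂ) →L[ℂ] (ℝ →ᵇ ℂ) := by
  classical exact if h : ∃ A, HasKernel V X A k then h.choose else 0

theorem KernelBound.hasKernel_kernelOp {V k : ℝ → ℂ} {X : ℝ} {h : ℝ → ℝ}
    (hV : ∀ X, IntegrableOn V (Ioi X) volume) (hk : KernelBound V X k h) :
    HasKernel V X (kernelOp V X k) k := by
  have := hk.exists_hasKernel hV
  rw [kernelOp, dif_pos this]
  exact this.choose_spec

/-- A monotone weight on `[0, ∞)` dominating `2 s e^{-2δs}` and integrable against `|V|`. -/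
structure WeightBound (V : ℝ → ℂ) (X δ : ℝ) (w : ℝ → ℝ) : Prop where
  delta : 0 ≤ δ
  mono : MonotoneOn w (Ici 0)
  le : ∀ s, 0 ≤ s → 2 * s * Real.exp (-(2 * δ * s)) ≤ w s
  int : IntegrableOn (fun t => w (t - X) * ‖V t‖) (Ioi X) volume

/-- The weighted integral of `|V|` that controls increments of the exponential kernel. -/
def modulus (V : ℝ → ℂ) (X : ℝ) (w : ℝ → ℝ) (η : ℝ) : ℝ :=
  ∫ t in Ioi X, w (t - X) * min 2 (2 * (t - X) * η) * ‖V t‖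

section

variable {V : ℝ → ℂ} {X δ η c : ℝ} {w : ℝ → ℝ} {k : ℝ → ℂ} {σ τ : ℂ}

theorem integrable_modulus (hwi : IntegrableOn (fun t => w (t - X) * ‖V t‖) (Ioi X) volume)
    (hη : 0 ≤ η) :
    IntegrableOn (fun t => w (t - X) * min 2 (2 * (t - X) * η) * ‖V t‖) (Ioi X) volume := by
  have : (fun t => w (t - X) * min 2 (2 * (t - X) * η) * ‖V t‖) =
      fun t => min 2 (2 * (t - X) * η) * (w (t - X) * ‖V t‖) := by
    funext t; ring
  rw [this]
  refine Integrable.bdd_mul (c := 2) hwi ?_ ?_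
  · exact Continuous.aestronglyMeasurable (by fun_prop)
  · refine (ae_restrict_iff' measurableSet_Ioi).2 (ae_of_all _ fun t ht => ?_)
    have : 0 ≤ 2 * (t - X) * η := by
      have : 0 < t - X := sub_pos.2 ht
      positivity
    rw [Real.norm_of_nonneg (le_min (by norm_num) this)]
    exact min_le_left _ _

/-- Dominated convergence with majorant `2 w |V|`: the factor `min 2 (2 (t - X) u)` tends to zero
for each `t`. -/
theorem tendsto_modulus {ι : Type*} {l : Filter ι} [l.IsCountablyGenerated] {u : ι → ℝ}
    (hwi : IntegrableOn (fun t => w (t - X) * ‖V t‖) (Ioi X) volume)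
    (hu : Tendsto u l (𝓝 0)) (hu0 : ∀ i, 0 ≤ u i) :
    Tendsto (fun i => modulus V X w (u i)) l (𝓝 0) := by
  have h0 : ∫ t in Ioi X, (fun _ => (0 : ℝ)) t = 0 := by simp
  rw [← h0]
  refine tendsto_integral_filter_of_dominated_convergence (fun t => 2 * ‖w (t - X) * ‖V t‖‖)
    (Eventually.of_forall fun i => (integrable_modulus hwi (hu0 i)).aestronglyMeasurable)
    (Eventually.of_forall fun i => ?_) (hwi.norm.const_mul 2) (ae_of_all _ fun t => ?_)
  · refine (ae_restrict_iff' measurableSet_Ioi).2 (ae_of_all _ fun t ht => ?_)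
    have h1 : 0 ≤ 2 * (t - X) * u i := by
      have : 0 < t - X := sub_pos.2 ht
      have := hu0 i
      positivity
    have h2 : w (t - X) * min 2 (2 * (t - X) * u i) * ‖V t‖ =
      min 2 (2 * (t - X) * u i) * (w (t - X) * ‖V t‖) := by ring
    rw [h2, norm_mul, Real.norm_of_nonneg (le_min (by norm_num) h1)]
    gcongr
    exact min_le_left _ _
  · have h1 : Tendsto (fun i => min 2 (2 * (t - X) * u i)) l (𝓝 (min 2 (2 * (t - X) * 0))) :=
      (tendsto_const_nhds).min (hu.const_mul _)
    have h2 := (h1.const_mul (w (t - X))).mul_const ‖V t‖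
    simpa using h2

theorem kernelBound_modulus (hmono : MonotoneOn w (Ici 0)) (h0 : ∀ s, 0 ≤ s → 0 ≤ w s)
    (hwi : IntegrableOn (fun t => w (t - X) * ‖V t‖) (Ioi X) volume)
    (hη : 0 ≤ η) (hc : 0 ≤ c) (hk : Continuous k)
    (hle : ∀ s, 0 ≤ s → ‖k s‖ ≤ c * (w s * min 2 (2 * s * η))) :
    KernelBound V X k (fun s => c * (w s * min 2 (2 * s * η))) := by
  refine ⟨hk, fun s hs t ht hst => ?_, hle, ?_⟩
  · have hs' : 0 ≤ s := hs
    have := h0 t ht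
    have : 0 ≤ min 2 (2 * s * η) := le_min (by norm_num) (by positivity)
    have := hmono hs ht hst
    gcongr
  · refine ((integrable_modulus hwi hη).const_mul c).congr (ae_of_all _ fun t => ?_)
    simp only; ring

theorem HasKernel.opNorm_le_modulus {A : (ℝ →ᵇ ℂ) →L[ℂ] (ℝ →ᵇ ℂ)} (hA : HasKernel V X A k)
    (hmono : MonotoneOn w (Ici 0)) (h0 : ∀ s, 0 ≤ s → 0 ≤ w s)
    (hwi : IntegrableOn (fun t => w (t - X) * ‖V t‖) (Ioi X) volume)
    (hη : 0 ≤ η) (hc : 0 ≤ c) (hk : Continuous k)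
    (hle : ∀ s, 0 ≤ s → ‖k s‖ ≤ c * (w s * min 2 (2 * s * η))) :
    ‖A‖ ≤ c * modulus V X w η := by
  refine (hA.opNorm_le (kernelBound_modulus hmono h0 hwi hη hc hk hle)).trans (le_of_eq ?_)
  rw [modulus, ← integral_const_mul]
  exact integral_congr_ae (ae_of_all _ fun t => by simp only; ring)

theorem kernelBound_expKernel (hV : ∀ X, IntegrableOn V (Ioi X) volume) (hσ : σ.re ≤ 0) :
    KernelBound V X (expKernel σ) (fun _ => 1) :=
  ⟨continuous_expKernel σ, monotoneOn_const, fun _ hs => norm_expKernel_le_one hs hσ,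
    by simpa using! (hV X).norm⟩

theorem WeightBound.kernelBound_dexpKernel (hw : WeightBound V X δ w) (hσ : σ.re ≤ -δ) :
    KernelBound V X (dexpKernel σ) w :=
  ⟨continuous_dexpKernel σ, hw.mono, fun s hs => (norm_dexpKernel_le hs hσ).trans (hw.le s hs),
    hw.int⟩

theorem WeightBound.nonneg (hw : WeightBound V X δ w) (s : ℝ) (hs : 0 ≤ s) : 0 ≤ w s :=
  le_trans (by positivity) (hw.le s hs)

/-- The Volterra operator with kernel `e^{2σs}`. -/
def expOp (V : ℝ → ℂ) (X : ℝ) (σ : ℂ) : (ℝ →ᵇ ℂ) →L[ℂ] (ℝ →ᵇ ℂ) := kernelOp V X (expKernel σ)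

/-- The Volterra operator with kernel `2 s e^{2σs}`. -/
def dexpOp (V : ℝ → ℂ) (X : ℝ) (σ : ℂ) : (ℝ →ᵇ ℂ) →L[ℂ] (ℝ →ᵇ ℂ) := kernelOp V X (dexpKernel σ)

theorem hasKernel_expOp (hV : ∀ X, IntegrableOn V (Ioi X) volume) (hσ : σ.re ≤ 0) :
    HasKernel V X (expOp V X σ) (expKernel σ) :=
  (kernelBound_expKernel hV hσ).hasKernel_kernelOp hV

/-- Weight `1` suffices, so integrability of `V` alone gives norm continuity up to and including the
line `Re σ = 0`. -/
theorem continuousOn_expOp (hV : ∀ X, IntegrableOn V (Ioi X) volume) :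
    ContinuousOn (expOp V X) {z | z.re ≤ 0} := by
  intro σ hσ
  rw [ContinuousWithinAt, tendsto_iff_norm_sub_tendsto_zero]
  have hu : Tendsto (fun τ : ℂ => ‖τ - σ‖) (𝓝[{z | z.re ≤ 0}] σ) (𝓝 0) := by
    have : Continuous fun τ : ℂ => ‖τ - σ‖ := by fun_prop
    simpa using (this.tendsto σ).mono_left nhdsWithin_le_nhds
  let w : ℝ → ℝ := fun _ => 1
  have hwi : IntegrableOn (fun t => w (t - X) * ‖V t‖) (Ioi X) volume := by
    simpa [w] using! (hV X).norm
  refine squeeze_zero' (Eventually.of_forall fun _ => norm_nonneg _) ?_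
    (tendsto_modulus hwi hu fun _ => norm_nonneg _)
  filter_upwards [self_mem_nhdsWithin] with τ hτ
  have h := (hasKernel_expOp (X := X) hV hτ).sub hV (hasKernel_expOp hV hσ)
    (kernelBound_expKernel hV hτ) (kernelBound_expKernel hV hσ)
  have := h.opNorm_le_modulus (c := 1) (w := w) monotoneOn_const (fun _ _ => zero_le_one) hwi
    (norm_nonneg (τ - σ)) zero_le_one ((continuous_expKernel τ).sub (continuous_expKernel σ))
    (fun s hs => ?_)
  · simpa using this
  · simpa [w] using norm_expKernel_sub_le (δ := 0) hs (by simpa using hσ) (by simpa using hτ)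

/-- The Taylor remainder of the kernel bounds the operator remainder by `‖τ - σ‖` times a modulus
that tends to zero. The derivative is taken within the half-plane because for `δ = 0` the relevant
`σ` lie on its boundary. -/
theorem WeightBound.hasDerivWithinAt_expOp (hV : ∀ X, IntegrableOn V (Ioi X) volume)
    (hw : WeightBound V X δ w) (hσ : σ.re ≤ -δ) :
    HasDerivWithinAt (expOp V X) (dexpOp V X σ) {z | z.re ≤ -δ} σ := by
  have key : (fun τ => expOp V X τ - expOp V X σ - (τ - σ) • dexpOp V X σ)
      =o[𝓝[{z | z.re ≤ -δ}] σ] fun τ => τ - σ := by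
    rw [isLittleO_iff]
    intro c hc
    have hu : Tendsto (fun τ : ℂ => ‖τ - σ‖) (𝓝[{z | z.re ≤ -δ}] σ) (𝓝 0) := by
      have : Continuous fun τ : ℂ => ‖τ - σ‖ := by fun_prop
      simpa using (this.tendsto σ).mono_left nhdsWithin_le_nhds
    have hm := (tendsto_modulus hw.int hu fun _ => norm_nonneg _).eventually (gt_mem_nhds hc)
    filter_upwards [hm, self_mem_nhdsWithin] with τ h1 hτ
    have h0 : -δ ≤ 0 := neg_nonpos.2 hw.delta
    have hd := hw.kernelBound_dexpKernel hσ
    have hsub := (hasKernel_expOp (X := X) hV (hτ.trans h0)).sub hV (hasKernel_expOp hV (hσ.trans h0))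
      (kernelBound_expKernel hV (hτ.trans h0)) (kernelBound_expKernel hV (hσ.trans h0))
    have hsubb : KernelBound V X (fun s => expKernel τ s - expKernel σ s) (fun _ => 2) := by
      refine ⟨(continuous_expKernel τ).sub (continuous_expKernel σ), monotoneOn_const,
        fun s hs => (norm_sub_le _ _).trans ?_, (hV X).norm.const_mul 2⟩
      linarith [norm_expKernel_le_one hs (hτ.trans h0), norm_expKernel_le_one hs (hσ.trans h0)]
    have hdb : KernelBound V X (fun s => (τ - σ) * dexpKernel σ s) (fun s => ‖τ - σ‖ * w s) := by
      refine ⟨continuous_const.mul (continuous_dexpKernel σ), fun s hs t ht hst => ?_,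
        fun s hs => ?_, ?_⟩
      · exact mul_le_mul_of_nonneg_left (hw.mono hs ht hst) (norm_nonneg _)
      · rw [norm_mul]
        exact mul_le_mul_of_nonneg_left (hd.le s hs) (norm_nonneg _)
      · simpa [mul_assoc] using! hw.int.const_mul ‖τ - σ‖
    have h := hsub.sub hV ((hd.hasKernel_kernelOp hV).smul (τ - σ)) hsubb hdb
    have := h.opNorm_le_modulus hw.mono hw.nonneg hw.int (norm_nonneg (τ - σ))
      (norm_nonneg (τ - σ)) (hsubb.cont.sub hdb.cont) (fun s hs => ?_)
    · refine this.trans ?_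
      rw [mul_comm]
      exact mul_le_mul_of_nonneg_right h1.le (norm_nonneg _)
    · refine (norm_expKernel_taylor_le hs hσ hτ).trans ?_
      have : 0 ≤ min 2 (2 * s * ‖τ - σ‖) := le_min (by norm_num) (by positivity)
      have := hw.le s hs
      gcongr
  exact (hasDerivWithinAt_iff_isLittleO (𝕜 := ℂ) (F := (ℝ →ᵇ ℂ) →L[ℂ] (ℝ →ᵇ ℂ))
    (f := expOp V X)).2 key

theorem WeightBound.continuousOn_dexpOp (hV : ∀ X, IntegrableOn V (Ioi X) volume)
    (hw : WeightBound V X δ w) : ContinuousOn (dexpOp V X) {z | z.re ≤ -δ} := by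
  intro σ hσ
  rw [ContinuousWithinAt, tendsto_iff_norm_sub_tendsto_zero]
  have hu : Tendsto (fun τ : ℂ => ‖τ - σ‖) (𝓝[{z | z.re ≤ -δ}] σ) (𝓝 0) := by
    have : Continuous fun τ : ℂ => ‖τ - σ‖ := by fun_prop
    simpa using (this.tendsto σ).mono_left nhdsWithin_le_nhds
  refine squeeze_zero' (Eventually.of_forall fun _ => norm_nonneg _) ?_
    (tendsto_modulus hw.int hu fun _ => norm_nonneg _)
  filter_upwards [self_mem_nhdsWithin] with τ hτ
  have hτb := hw.kernelBound_dexpKernel hτ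
  have hσb := hw.kernelBound_dexpKernel hσ
  have h := (hτb.hasKernel_kernelOp hV).sub hV (hσb.hasKernel_kernelOp hV) hτb hσb
  have := h.opNorm_le_modulus (c := 1) hw.mono hw.nonneg hw.int
    (norm_nonneg (τ - σ)) zero_le_one (hτb.cont.sub hσb.cont) (fun s hs => ?_)
  · simpa [dexpOp] using this
  · have h1 : dexpKernel τ s - dexpKernel σ s = 2 * s * (expKernel τ s - expKernel σ s) := by
      simp only [dexpKernel, expKernel]; ring
    have h2 : ‖(2 * (s : ℂ))‖ = 2 * s := by
      rw [norm_mul, Complex.norm_real, Real.norm_of_nonneg hs]; simp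
    have h3 : 0 ≤ min 2 (2 * s * ‖τ - σ‖) := le_min (by norm_num) (by positivity)
    have := hw.le s hs
    rw [h1, norm_mul, h2, one_mul]
    calc 2 * s * ‖expKernel τ s - expKernel σ s‖
        ≤ 2 * s * (Real.exp (-(2 * δ * s)) * min 2 (2 * s * ‖τ - σ‖)) := by
          gcongr; exact norm_expKernel_sub_le hs hσ hτ
      _ = 2 * s * Real.exp (-(2 * δ * s)) * min 2 (2 * s * ‖τ - σ‖) := by ring
      _ ≤ _ := by gcongr

end

/-! ### The Jost solution for `Re σ ≤ 0` -/

/-- The Volterra operator with kernel `(e^{2σs} - 1) / (2σ)`. -/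
def jostOp (V : ℝ → ℂ) (X : ℝ) (σ : ℂ) : (ℝ →ᵇ ℂ) →L[ℂ] (ℝ →ᵇ ℂ) :=
  (2 * σ)⁻¹ • (expOp V X σ - expOp V X 0)

/-- The solution of the integral equation `m = 1 + jostOp m` on `[X, ∞)`. -/
def jostB (V : ℝ → ℂ) (X : ℝ) (σ : ℂ) : ℝ →ᵇ ℂ :=
  Ring.inverse (1 - jostOp V X σ) 1

section

variable {V : ℝ → ℂ} {X x : ℝ} {σ : ℂ}

theorem kernelBound_expKernel_sub (hV : ∀ X, IntegrableOn V (Ioi X) volume) (hσ : σ.re ≤ 0) :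
    KernelBound V X (fun s => expKernel σ s - expKernel 0 s) (fun _ => 2) := by
  refine ⟨(continuous_expKernel σ).sub (continuous_expKernel 0), monotoneOn_const,
      fun s hs => (norm_sub_le _ _).trans ?_, (hV X).norm.const_mul 2⟩
  linarith [norm_expKernel_le_one hs hσ, norm_expKernel_le_one (σ := 0) hs (by simp)]

theorem hasKernel_jostOp (hV : ∀ X, IntegrableOn V (Ioi X) volume) (hσ : σ.re ≤ 0) :
    HasKernel V X (jostOp V X σ) (fun s => (2 * σ)⁻¹ * (expKernel σ s - expKernel 0 s)) :=
  ((hasKernel_expOp hV hσ).sub hV (hasKernel_expOp hV (by simp)) (kernelBound_expKernel hV hσ)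
    (kernelBound_expKernel hV (by simp))).smul _

theorem isUnit_one_sub_jostOp (hV : ∀ X, IntegrableOn V (Ioi X) volume) (hσ : σ.re ≤ 0) :
    IsUnit (1 - jostOp V X σ) := by
  refine (hasKernel_jostOp hV hσ).isUnit_one_sub (C := ‖(2 * σ)⁻¹‖ * 2) hV fun s hs => ?_
  rw [norm_mul]
  exact mul_le_mul_of_nonneg_left ((kernelBound_expKernel_sub (X := 0) hV hσ).le s hs)
    (norm_nonneg _)

theorem jostB_eq (hV : ∀ X, IntegrableOn V (Ioi X) volume) (hσ : σ.re ≤ 0) :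
    jostB V X σ = 1 + jostOp V X σ (jostB V X σ) := by
  have h := Ring.mul_inverse_cancel _ (isUnit_one_sub_jostOp (X := X) hV hσ)
  have h2 := congrArg (fun A : (ℝ →ᵇ ℂ) →L[ℂ] (ℝ →ᵇ ℂ) => A 1) h
  simp only [mul_apply_eq_comp, FunLike.coe_sub, Pi.sub_apply, one_apply_eq_self] at h2
  exact sub_eq_iff_eq_add.mp h2

theorem eq_jostB (hV : ∀ X, IntegrableOn V (Ioi X) volume) (hσ : σ.re ≤ 0) {g : ℝ →ᵇ ℂ}
    (hg : g = 1 + jostOp V X σ g) : g = jostB V X σ := by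
  have h := Ring.inverse_mul_cancel _ (isUnit_one_sub_jostOp (X := X) hV hσ)
  have h2 := congrArg (fun A : (ℝ →ᵇ ℂ) →L[ℂ] (ℝ →ᵇ ℂ) => A g) h
  simp only [mul_apply_eq_comp, FunLike.coe_sub, Pi.sub_apply, one_apply_eq_self] at h2
  rw [← h2, jostB]
  congr 1
  exact sub_eq_iff_eq_add.mpr hg

theorem volterra_congr {k g₁ g₂ : ℝ → ℂ} (h : ∀ t, x < t → g₁ t = g₂ t) :
    volterra V k g₁ x = volterra V k g₂ x :=
  setIntegral_congr_fun measurableSet_Ioi fun t ht => by simp only [h t ht]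

/-- The Volterra equation at `x` sees only values to the right of `x`, so the solution for `X`,
frozen to the left of `X'`, solves the equation for `X'`; uniqueness applies. Hence the solutions on
half-lines glue to one function on `ℝ`. -/
theorem jostB_eq_of_le (hV : ∀ X, IntegrableOn V (Ioi X) volume) (hσ : σ.re ≤ 0) {X' : ℝ}
    (hX : X ≤ X') (hx : X' ≤ x) : jostB V X σ x = jostB V X' σ x := by
  let c : C(ℝ, ℝ) := ⟨fun x => max x X', by fun_prop⟩
  have key : (jostB V X σ).compContinuous c = jostB V X' σ := by
    refine eq_jostB hV hσ ?_
    ext y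
    have h1 := DFunLike.congr_fun (jostB_eq (X := X) hV hσ) (max y X')
    simp only [BoundedContinuousFunction.compContinuous_apply, BoundedContinuousFunction.coe_add,
      Pi.add_apply, BoundedContinuousFunction.coe_one, Pi.one_apply, c,
      ContinuousMap.coe_mk] at h1 ⊢
    rw [hasKernel_jostOp hV hσ] at h1 ⊢
    rw [h1, max_eq_left (hX.trans (le_max_right y X'))]
    congr 1
    refine volterra_congr fun t ht => ?_
    have : X' ≤ t := (le_max_right y X').trans ht.le
    simp [max_eq_left this]
  rw [← key]
  simp [c, max_eq_left hx]

/-- The normalised Jost solution `m = e^{-σx} y`. -/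
def jostM (V : ℝ → ℂ) (σ : ℂ) (x : ℝ) : ℂ := jostB V x σ x

/-- The integral `∫_x^∞ e^{2σ(t-x)} V(t) m(t) dt`. -/
def jostR (V : ℝ → ℂ) (σ : ℂ) (x : ℝ) : ℂ := volterra V (expKernel σ) (jostM V σ) x

theorem jostM_eq_jostB (hV : ∀ X, IntegrableOn V (Ioi X) volume) (hσ : σ.re ≤ 0) (hx : X ≤ x) :
    jostM V σ x = jostB V X σ x :=
  (jostB_eq_of_le hV hσ hx le_rfl).symm

theorem jostR_eq (hV : ∀ X, IntegrableOn V (Ioi X) volume) (hσ : σ.re ≤ 0) (hx : X ≤ x) :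
    jostR V σ x = expOp V X σ (jostB V X σ) x := by
  rw [hasKernel_expOp hV hσ, max_eq_left hx]
  exact volterra_congr fun t ht => jostM_eq_jostB hV hσ (hx.trans ht.le)

theorem continuous_jostM (hV : ∀ X, IntegrableOn V (Ioi X) volume) (hσ : σ.re ≤ 0) :
    Continuous (jostM V σ) := by
  rw [continuous_iff_continuousAt]
  intro x
  refine ((jostB V (x - 1) σ).continuous.continuousAt).congr ?_
  filter_upwards [lt_mem_nhds (sub_one_lt x)] with y hy using
    (jostM_eq_jostB hV hσ hy.le).symm

theorem norm_jostM_le (hV : ∀ X, IntegrableOn V (Ioi X) volume) (hσ : σ.re ≤ 0) (hx : X ≤ x) :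
    ‖jostM V σ x‖ ≤ ‖jostB V X σ‖ := by
  rw [jostM_eq_jostB hV hσ hx]
  exact BoundedContinuousFunction.norm_coe_le_norm _ _

theorem integrableOn_mul_jostM (hV : ∀ X, IntegrableOn V (Ioi X) volume) (hσ : σ.re ≤ 0)
    {k : ℝ → ℂ} (hk : Continuous k) (hk1 : ∀ X, ∃ C, ∀ t, X < t → ‖k t‖ ≤ C) (X : ℝ) :
    IntegrableOn (fun t => k t * (V t * jostM V σ t)) (Ioi X) volume := by
  obtain ⟨C, hC⟩ := hk1 X
  refine Integrable.bdd_mul (c := C) (Integrable.mul_bdd (c := ‖jostB V X σ‖) (hV X)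
    (continuous_jostM hV hσ).aestronglyMeasurable ?_) hk.aestronglyMeasurable ?_
  · exact (ae_restrict_iff' measurableSet_Ioi).2 (ae_of_all _ fun t ht =>
      norm_jostM_le hV hσ (le_of_lt ht))
  · exact (ae_restrict_iff' measurableSet_Ioi).2 (ae_of_all _ fun t ht => hC t ht)

theorem expKernel_bounded (hσ : σ.re ≤ 0) (X : ℝ) :
    ∃ C, ∀ t, X < t → ‖expKernel σ t‖ ≤ C := by
  refine ⟨Real.exp (2 * σ.re * X), fun t ht => ?_⟩
  rw [expKernel, Complex.norm_exp]
  refine Real.exp_le_exp.2 ?_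
  have : (2 * σ * (t : ℂ)).re = 2 * σ.re * t := by simp [Complex.mul_re]
  rw [this]
  nlinarith

/-- Splitting `e^{2σ(t-x)}` removes `x` from the integrand and leaves a tail integral, which can be
differentiated by the product rule. -/
theorem jostR_eq_exp_mul : jostR V σ x =
    expKernel σ (-x) * ∫ t in Ioi x, expKernel σ t * (V t * jostM V σ t) := by
  rw [jostR, volterra, ← integral_const_mul]
  refine integral_congr_ae (ae_of_all _ fun t => ?_)
  have : expKernel σ (t - x) = expKernel σ (-x) * expKernel σ t := by
    rw [expKernel, expKernel, expKernel, ← Complex.exp_add]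
    congr 1
    push_cast; ring
  simp only [this]; ring

theorem expKernel_zero (s : ℝ) : expKernel 0 s = 1 := by simp [expKernel]

theorem jostM_eq (hV : ∀ X, IntegrableOn V (Ioi X) volume) (hσ : σ.re ≤ 0) (x : ℝ) :
    jostM V σ x = 1 + (2 * σ)⁻¹ * (jostR V σ x - ∫ t in Ioi x, V t * jostM V σ t) := by
  have h1 := DFunLike.congr_fun (jostB_eq (X := x) hV hσ) x
  simp only [BoundedContinuousFunction.coe_add,
      Pi.add_apply, BoundedContinuousFunction.coe_one, Pi.one_apply] at h1
  rw [jostM, h1, jostOp]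
  simp only [FunLike.coe_sub, Pi.sub_apply, FunLike.coe_smul, Pi.smul_apply,
    BoundedContinuousFunction.coe_sub, BoundedContinuousFunction.coe_smul, smul_eq_mul]
  rw [← jostR_eq hV hσ le_rfl, hasKernel_expOp hV (by simp), max_self,
    ← volterra_congr (fun t ht => jostM_eq_jostB hV hσ ht.le)]
  simp [volterra, expKernel_zero]

theorem tendsto_volterra_atTop (hV : ∀ X, IntegrableOn V (Ioi X) volume) (hσ : σ.re ≤ 0)
    {k : ℝ → ℂ} (hk : ∀ s, 0 ≤ s → ‖k s‖ ≤ 1) :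
    Tendsto (volterra V k (jostM V σ)) atTop (𝓝 0) := by
  rw [tendsto_zero_iff_norm_tendsto_zero]
  have h1 := (IsPrimitive.tendsto_tail (fun X => (hV X).norm)).mul_const ‖jostB V 0 σ‖
  rw [zero_mul] at h1
  refine squeeze_zero' (Eventually.of_forall fun _ => norm_nonneg _) ?_ h1
  filter_upwards [eventually_ge_atTop 0] with x hx
  rw [← integral_mul_const]
  refine norm_integral_le_of_norm_le ((hV x).norm.mul_const _) ?_
  refine (ae_restrict_iff' measurableSet_Ioi).2 (ae_of_all _ fun t ht => ?_)
  have h2 := norm_jostM_le (X := 0) hV hσ (hx.trans (le_of_lt ht))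
  have h3 := hk (t - x) (sub_nonneg.2 (le_of_lt ht))
  rw [norm_mul, norm_mul]
  calc ‖k (t - x)‖ * ‖V t‖ * ‖jostM V σ t‖ ≤ 1 * ‖V t‖ * ‖jostB V 0 σ‖ := by gcongr
    _ = _ := by ring

theorem tendsto_jostR (hV : ∀ X, IntegrableOn V (Ioi X) volume) (hσ : σ.re ≤ 0) :
    Tendsto (jostR V σ) atTop (𝓝 0) :=
  tendsto_volterra_atTop hV hσ fun _ hs => norm_expKernel_le_one hs hσ

theorem tendsto_jostM (hV : ∀ X, IntegrableOn V (Ioi X) volume) (hσ : σ.re ≤ 0) :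
    Tendsto (jostM V σ) atTop (𝓝 1) := by
  have h1 : Tendsto (fun x => ∫ t in Ioi x, V t * jostM V σ t) atTop (𝓝 0) := by
    refine (tendsto_volterra_atTop (k := fun _ => 1) hV hσ (by simp)).congr fun x => ?_
    simp [volterra]
  have h2 := (((tendsto_jostR hV hσ).sub h1).const_mul (2 * σ)⁻¹).const_add 1
  simp only [sub_zero, mul_zero, add_zero] at h2
  exact h2.congr fun x => (jostM_eq hV hσ x).symm

/-- The Jost solution, asymptotic to `e^{σx}`. -/
def jost (V : ℝ → ℂ) (σ : ℂ) (x : ℝ) : ℂ := Complex.exp (σ * x) * jostM V σ x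

/-- The derivative of the Jost solution. -/
def jostD (V : ℝ → ℂ) (σ : ℂ) (x : ℝ) : ℂ :=
  Complex.exp (σ * x) * (σ * jostM V σ x - jostR V σ x)

theorem isPrimitive_exp (σ : ℂ) :
    IsPrimitive (fun x : ℝ => Complex.exp (σ * x)) (fun x : ℝ => σ * Complex.exp (σ * x)) := by
  refine IsPrimitive.of_hasDerivAt (fun x => ?_) (by fun_prop)
  have := ((Complex.ofRealCLM.hasDerivAt (x := x)).const_mul σ).cexp
  simpa [mul_comm] using this

/-- Variation of constants: `y = e^{σx} + (e^{-σx} A - e^{σx} P)/(2σ)`, with tail integrals `A` of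
`e^{2σt} V m` and `P` of `V m`. In `y'` the terms containing `A'` and `P'` cancel; in `y''` they add
up to `V y`. -/
theorem jost_isPrimitive (hV : ∀ X, IntegrableOn V (Ioi X) volume) (hσ : σ.re ≤ 0) (h0 : σ ≠ 0) :
    IsPrimitive (jost V σ) (jostD V σ) ∧
      IsPrimitive (jostD V σ) (fun x => (σ ^ 2 + V x) * jost V σ x) := by
  have hA := IsPrimitive.tail (integrableOn_mul_jostM hV hσ (continuous_expKernel σ)
    (expKernel_bounded hσ))
  have hP : IsPrimitive (fun x => ∫ t in Ioi x, V t * jostM V σ t)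
      (fun x => -(V x * jostM V σ x)) := by
    refine IsPrimitive.tail fun X => ?_
    simpa using integrableOn_mul_jostM (k := fun _ => 1) hV hσ continuous_const
      (fun _ => ⟨1, by simp⟩) X
  have hE := isPrimitive_exp σ
  have hE' := isPrimitive_exp (-σ)
  set A : ℝ → ℂ := fun x => ∫ t in Ioi x, expKernel σ t * (V t * jostM V σ t) with hAdef
  set P : ℝ → ℂ := fun x => ∫ t in Ioi x, V t * jostM V σ t with hPdef
  have hR : ∀ x : ℝ, Complex.exp (σ * x) * jostR V σ x = Complex.exp (-σ * x) * A x := by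
    intro x
    rw [jostR_eq_exp_mul, ← mul_assoc, expKernel, ← Complex.exp_add]
    congr 2
    push_cast; ring
  have hk : ∀ x : ℝ, Complex.exp (-σ * x) * expKernel σ x = Complex.exp (σ * x) := by
    intro x
    rw [expKernel, ← Complex.exp_add]
    congr 1
    ring
  have hj : ∀ x : ℝ, Complex.exp (σ * x) + (2 * σ)⁻¹ * (Complex.exp (-σ * x) * A x -
      Complex.exp (σ * x) * P x) = jost V σ x := by
    intro x
    rw [jost, jostM_eq hV hσ, ← hR]
    ring
  have hjD : ∀ x : ℝ, σ * Complex.exp (σ * x) - 2⁻¹ * (Complex.exp (-σ * x) * A x +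
      Complex.exp (σ * x) * P x) = jostD V σ x := by
    intro x
    have h1 : σ * jost V σ x - Complex.exp (σ * x) * jostR V σ x = jostD V σ x := by
      rw [jost, jostD]; ring
    rw [← h1, hR, ← hj]
    field_simp
    ring
  refine ⟨(hE.add (((hE'.mul hA).sub (hE.mul hP)).const_mul (2 * σ)⁻¹)).congr hj fun x => ?_,
    ((hE.const_mul σ).sub (((hE'.mul hA).add (hE.mul hP)).const_mul 2⁻¹)).congr hjD fun x => ?_⟩
  · rw [← hjD]
    have := hk x
    simp only [neg_mul] at this ⊢
    field_simp
    linear_combination (-(V x * jostM V σ x)) * this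
  · have h2 : (σ ^ 2 + V x) * jost V σ x =
        σ ^ 2 * jost V σ x + V x * (Complex.exp (σ * x) * jostM V σ x) := by rw [jost]; ring
    rw [h2, ← hj]
    have := hk x
    simp only [neg_mul] at this ⊢
    field_simp
    linear_combination (V x * jostM V σ x) * this

end

/-! ### Dependence of the Jost solution on the parameter -/

section ContDiff

variable {V : ℝ → ℂ} {X δ : ℝ} {w : ℝ → ℝ} {I : Set ℝ} {s : ℝ → ℂ}

/-- Inversion in the Banach algebra of operators is smooth at units, so all regularity reduces to
that of `expOp` along the curve `s`. Used with `n = 0` and `n = 1`. -/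
theorem contDiffOn_jostB (hV : ∀ X, IntegrableOn V (Ioi X) volume) {n : WithTop ℕ∞}
    (hs : ContDiffOn ℝ n s I) (h0 : ∀ μ ∈ I, s μ ≠ 0) (hre : ∀ μ ∈ I, (s μ).re ≤ 0)
    (hE : ContDiffOn ℝ n (fun μ => expOp V X (s μ)) I) :
    ContDiffOn ℝ n (fun μ => jostB V X (s μ)) I ∧
      ContDiffOn ℝ n (fun μ => expOp V X (s μ) (jostB V X (s μ))) I := by
  have hK : ContDiffOn ℝ n (fun μ => 1 - jostOp V X (s μ)) I := by
    have h1 : ContDiffOn ℝ n (fun μ => (2 * s μ)⁻¹) I :=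
      (contDiffOn_const.mul hs).inv fun μ hμ => mul_ne_zero two_ne_zero (h0 μ hμ)
    have h2 : ContDiffOn ℝ n (fun μ => expOp V X (s μ) - expOp V X 0) I :=
      hE.sub contDiffOn_const
    have h3 : ContDiffOn ℝ n (fun μ => jostOp V X (s μ)) I := h1.smul h2
    exact contDiffOn_const.sub h3
  have hinv : ContDiffOn ℝ n (fun μ => Ring.inverse (1 - jostOp V X (s μ))) I := by
    intro μ hμ
    obtain ⟨u, hu⟩ := isUnit_one_sub_jostOp (X := X) hV (hre μ hμ)
    have h1 := contDiffAt_ringInverse (R := (ℝ →ᵇ ℂ) →L[ℂ] (ℝ →ᵇ ℂ)) (n := n) ℝ u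
    rw [hu] at h1
    exact h1.comp_contDiffWithinAt μ (hK μ hμ)
  let ev : ((ℝ →ᵇ ℂ) →L[ℂ] (ℝ →ᵇ ℂ)) →L[ℝ] (ℝ →ᵇ ℂ) :=
    (ContinuousLinearMap.apply ℂ (ℝ →ᵇ ℂ) (1 : ℝ →ᵇ ℂ)).restrictScalars ℝ
  have hev : ContDiff ℝ n ev :=
    ContinuousLinearMap.contDiff (𝕜 := ℝ) (E := (ℝ →ᵇ ℂ) →L[ℂ] (ℝ →ᵇ ℂ)) (F := ℝ →ᵇ ℂ) ev
  have hmul : ContDiffOn ℝ n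
      (fun μ => expOp V X (s μ) * Ring.inverse (1 - jostOp V X (s μ))) I :=
    ContDiffOn.mul (𝔸 := (ℝ →ᵇ ℂ) →L[ℂ] (ℝ →ᵇ ℂ)) hE hinv
  have h2 : ContDiffOn ℝ n
      (fun μ => ev (expOp V X (s μ) * Ring.inverse (1 - jostOp V X (s μ)))) I :=
    hev.comp_contDiffOn hmul
  exact ⟨hev.comp_contDiffOn hinv, h2⟩

theorem continuousOn_expOp_comp (hV : ∀ X, IntegrableOn V (Ioi X) volume)
    (hs : ContinuousOn s I) (hre : ∀ μ ∈ I, (s μ).re ≤ 0) :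
    ContDiffOn ℝ 0 (fun μ => expOp V X (s μ)) I :=
  contDiffOn_zero.2 ((continuousOn_expOp hV).comp hs hre)

theorem WeightBound.contDiffOn_expOp_comp (hV : ∀ X, IntegrableOn V (Ioi X) volume)
    (hw : WeightBound V X δ w) (hI : IsOpen I) {s' : ℝ → ℂ}
    (hs : ∀ μ ∈ I, HasDerivAt s (s' μ) μ) (hs' : ContinuousOn s' I)
    (hre : ∀ μ ∈ I, (s μ).re ≤ -δ) :
    ContDiffOn ℝ 1 (fun μ => expOp V X (s μ)) I := by
  have hd : ∀ μ ∈ I, HasDerivAt (fun μ => expOp V X (s μ)) (s' μ • dexpOp V X (s μ)) μ := by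
    intro μ hμ
    have h1 := HasDerivWithinAt.scomp (F := (ℝ →ᵇ ℂ) →L[ℂ] (ℝ →ᵇ ℂ)) μ
      (hw.hasDerivWithinAt_expOp hV (hre μ hμ)) (hs μ hμ).hasDerivWithinAt hre
    exact h1.hasDerivAt (hI.mem_nhds hμ)
  have hsc : ContinuousOn s I := fun μ hμ => (hs μ hμ).continuousAt.continuousWithinAt
  have hc : ContinuousOn (fun μ => s' μ • dexpOp V X (s μ)) I :=
    hs'.smul ((hw.continuousOn_dexpOp hV).comp hsc hre)
  rw [show (1 : WithTop ℕ∞) = 0 + 1 from rfl, contDiffOn_succ_iff_deriv_of_isOpen hI]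
  refine ⟨fun μ hμ => (hd μ hμ).differentiableAt.differentiableWithinAt, by simp, ?_⟩
  rw [contDiffOn_zero]
  exact hc.congr fun μ hμ => (hd μ hμ).deriv

end ContDiff

section

variable {I : Set ℝ} {s s' : ℝ → ℂ} {f : ℝ → ℝ → ℂ}

theorem continuousOn_eval {F : ℝ → (ℝ →ᵇ ℂ)} (hF : ContinuousOn F I) :
    ContinuousOn (fun p : ℝ × ℝ => F p.2 p.1) (univ ×ˢ I) := by
  have h1 : ContinuousOn (fun p : ℝ × ℝ => ((F p.2, p.1) : (ℝ →ᵇ ℂ) × ℝ)) (univ ×ˢ I) :=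
    (hF.comp continuous_snd.continuousOn fun p hp => hp.2).prodMk continuous_fst.continuousOn
  exact (continuous_eval (F := ℝ →ᵇ ℂ)).comp_continuousOn h1

theorem continuousOn_exp_mul_eval {F : ℝ → (ℝ →ᵇ ℂ)} (hs : ContinuousOn s I)
    (hF : ContinuousOn F I) :
    ContinuousOn (fun p : ℝ × ℝ => Complex.exp (s p.2 * p.1) * F p.2 p.1) (univ ×ˢ I) := by
  have h1 : ContinuousOn (fun p : ℝ × ℝ => s p.2) (univ ×ˢ I) :=
    hs.comp continuous_snd.continuousOn fun p hp => hp.2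
  have h2 : ContinuousOn (fun p : ℝ × ℝ => (p.1 : ℂ)) (univ ×ˢ I) := by fun_prop
  exact (h1.mul h2).cexp.mul (continuousOn_eval hF)

/-- Continuity is local in `x`, so a formula valid on each half-line `[X, ∞)` suffices; near `x` the
one with `X = x - 1` is used. -/
theorem continuousOn_of_forall_Ioi {g : ℝ × ℝ → ℂ}
    (h : ∀ X, ∃ G : ℝ × ℝ → ℂ, ContinuousOn G (univ ×ˢ I) ∧
      ∀ x, X ≤ x → ∀ μ ∈ I, g (x, μ) = G (x, μ)) :
    ContinuousOn g (univ ×ˢ I) := by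
  rintro ⟨x, μ⟩ hp
  obtain ⟨G, hG, he⟩ := h (x - 1)
  refine (hG (x, μ) hp).congr_of_eventuallyEq ?_ (he x (by linarith) μ hp.2)
  have h1 : ∀ᶠ p : ℝ × ℝ in 𝓝[univ ×ˢ I] (x, μ), x - 1 < p.1 :=
    nhdsWithin_le_nhds ((continuous_fst.tendsto (x, μ)).eventually (lt_mem_nhds (sub_one_lt x)))
  filter_upwards [h1, self_mem_nhdsWithin] with p hp1 hp2
  exact he p.1 hp1.le p.2 hp2.2

theorem continuousOn_of_representation (hs : ContinuousOn s I)
    (h : ∀ X, ∃ F : ℝ → (ℝ →ᵇ ℂ), ContinuousOn F I ∧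
      ∀ x, X ≤ x → ∀ μ ∈ I, f x μ = Complex.exp (s μ * x) * F μ x) :
    ContinuousOn (fun p : ℝ × ℝ => f p.1 p.2) (univ ×ˢ I) := by
  refine continuousOn_of_forall_Ioi fun X => ?_
  obtain ⟨F, hF, he⟩ := h X
  exact ⟨_, continuousOn_exp_mul_eval hs hF, he⟩

theorem differentiable_of_representation (hI : IsOpen I)
    (hs : ∀ μ ∈ I, HasDerivAt s (s' μ) μ) (hs' : ContinuousOn s' I)
    (h : ∀ X, ∃ F : ℝ → (ℝ →ᵇ ℂ), ContDiffOn ℝ 1 F I ∧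
      ∀ x, X ≤ x → ∀ μ ∈ I, f x μ = Complex.exp (s μ * x) * F μ x) :
    (∀ x, ∀ μ ∈ I, DifferentiableAt ℝ (f x) μ) ∧
      ContinuousOn (fun p : ℝ × ℝ => deriv (f p.1) p.2) (univ ×ˢ I) := by
  have key : ∀ (F : ℝ → (ℝ →ᵇ ℂ)), ContDiffOn ℝ 1 F I → ∀ X,
      (∀ x, X ≤ x → ∀ μ ∈ I, f x μ = Complex.exp (s μ * x) * F μ x) →
      ∀ x, X ≤ x → ∀ μ ∈ I, HasDerivAt (f x)
        (Complex.exp (s μ * x) * (s' μ * x) * F μ x + Complex.exp (s μ * x) * deriv F μ x) μ := by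
    intro F hF X he x hx μ hμ
    have hFd : HasDerivAt F (deriv F μ) μ :=
      ((hF.differentiableOn one_ne_zero μ hμ).differentiableAt (hI.mem_nhds hμ)).hasDerivAt
    let ev : (ℝ →ᵇ ℂ) →L[ℝ] ℂ := (BoundedContinuousFunction.evalCLM ℂ x).restrictScalars ℝ
    have hev : HasDerivAt (fun μ => F μ x) (deriv F μ x) μ :=
      ev.hasFDerivAt.comp_hasDerivAt μ hFd
    have hexp := ((hs μ hμ).mul_const (x : ℂ)).cexp
    refine (hexp.mul hev).congr_of_eventuallyEq ?_
    filter_upwards [hI.mem_nhds hμ] with ν hν using he x hx ν hν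
  refine ⟨fun x μ hμ => ?_, ?_⟩
  · obtain ⟨F, hF, he⟩ := h x
    exact (key F hF x he x le_rfl μ hμ).differentiableAt
  · refine continuousOn_of_forall_Ioi fun X => ?_
    obtain ⟨F, hF, he⟩ := h X
    refine ⟨fun p => Complex.exp (s p.2 * p.1) * (s' p.2 * p.1) * F p.2 p.1 +
      Complex.exp (s p.2 * p.1) * deriv F p.2 p.1, ?_,
      fun x hx μ hμ => (key F hF X he x hx μ hμ).deriv⟩
    have hsc : ContinuousOn s I := fun μ hμ => (hs μ hμ).continuousAt.continuousWithinAt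
    have h1 : ContinuousOn (fun p : ℝ × ℝ => s p.2) (univ ×ˢ I) :=
      hsc.comp continuous_snd.continuousOn fun p hp => hp.2
    have h1' : ContinuousOn (fun p : ℝ × ℝ => s' p.2) (univ ×ˢ I) :=
      hs'.comp continuous_snd.continuousOn fun p hp => hp.2
    have h2 : ContinuousOn (fun p : ℝ × ℝ => (p.1 : ℂ)) (univ ×ˢ I) := by fun_prop
    exact (((h1.mul h2).cexp.mul (h1'.mul h2)).mul (continuousOn_eval hF.continuousOn)).add
      ((h1.mul h2).cexp.mul
        (continuousOn_eval (hF.continuousOn_deriv_of_isOpen hI le_rfl)))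

end

section

variable {V : ℝ → ℂ} {I : Set ℝ} {s s' : ℝ → ℂ}

/-- Separates the unbounded factor `e^{σx}` from a curve in a Banach space, where regularity in `μ`
is uniform in `x`; joint continuity in `(x, μ)` then comes from continuity of evaluation. -/
theorem jost_representation (hV : ∀ X, IntegrableOn V (Ioi X) volume) {n : WithTop ℕ∞} (X : ℝ)
    (hs : ContDiffOn ℝ n s I) (h0 : ∀ μ ∈ I, s μ ≠ 0) (hre : ∀ μ ∈ I, (s μ).re ≤ 0)
    (hE : ContDiffOn ℝ n (fun μ => expOp V X (s μ)) I) :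
    (∃ F : ℝ → (ℝ →ᵇ ℂ), ContDiffOn ℝ n F I ∧
      ∀ x, X ≤ x → ∀ μ ∈ I, jost V (s μ) x = Complex.exp (s μ * x) * F μ x) ∧
    (∃ F : ℝ → (ℝ →ᵇ ℂ), ContDiffOn ℝ n F I ∧
      ∀ x, X ≤ x → ∀ μ ∈ I, jostD V (s μ) x = Complex.exp (s μ * x) * F μ x) := by
  obtain ⟨h1, h2⟩ := contDiffOn_jostB hV hs h0 hre hE
  refine ⟨⟨_, h1, fun x hx μ hμ => ?_⟩, ⟨_, (hs.smul h1).sub h2, fun x hx μ hμ => ?_⟩⟩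
  · rw [jost, jostM_eq_jostB hV (hre μ hμ) hx]
  · rw [jostD, jostM_eq_jostB hV (hre μ hμ) hx, jostR_eq hV (hre μ hμ) hx]
    simp

theorem continuousOn_jost (hV : ∀ X, IntegrableOn V (Ioi X) volume)
    (hs : ContinuousOn s I) (h0 : ∀ μ ∈ I, s μ ≠ 0) (hre : ∀ μ ∈ I, (s μ).re ≤ 0) :
    ContinuousOn (fun p : ℝ × ℝ => jost V (s p.2) p.1) (univ ×ˢ I) ∧
    ContinuousOn (fun p : ℝ × ℝ => jostD V (s p.2) p.1) (univ ×ˢ I) := by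
  have h := fun X => jost_representation hV X (contDiffOn_zero.2 hs) h0 hre
    (continuousOn_expOp_comp hV hs hre)
  refine ⟨continuousOn_of_representation (f := fun x μ => jost V (s μ) x) hs fun X => ?_,
    continuousOn_of_representation (f := fun x μ => jostD V (s μ) x) hs fun X => ?_⟩
  · obtain ⟨F, hF, he⟩ := (h X).1
    exact ⟨F, hF.continuousOn, he⟩
  · obtain ⟨F, hF, he⟩ := (h X).2
    exact ⟨F, hF.continuousOn, he⟩

theorem differentiable_jost (hV : ∀ X, IntegrableOn V (Ioi X) volume) (hI : IsOpen I)
    (hs : ∀ μ ∈ I, HasDerivAt s (s' μ) μ) (hs' : ContinuousOn s' I) {δ : ℝ}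
    (h0 : ∀ μ ∈ I, s μ ≠ 0) (hre : ∀ μ ∈ I, (s μ).re ≤ -δ)
    (hw : ∀ X, ∃ w, WeightBound V X δ w) :
    ((∀ x, ∀ μ ∈ I, DifferentiableAt ℝ (fun μ => jost V (s μ) x) μ) ∧
      ContinuousOn (fun p : ℝ × ℝ => deriv (fun μ => jost V (s μ) p.1) p.2) (univ ×ˢ I)) ∧
    ((∀ x, ∀ μ ∈ I, DifferentiableAt ℝ (fun μ => jostD V (s μ) x) μ) ∧
      ContinuousOn (fun p : ℝ × ℝ => deriv (fun μ => jostD V (s μ) p.1) p.2) (univ ×ˢ I)) := by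
  have hδ : 0 ≤ δ := by
    obtain ⟨w, hw⟩ := hw 0
    exact hw.delta
  have hsc : ContDiffOn ℝ 1 s I := by
    rw [show (1 : WithTop ℕ∞) = 0 + 1 from rfl, contDiffOn_succ_iff_deriv_of_isOpen hI]
    refine ⟨fun μ hμ => (hs μ hμ).differentiableAt.differentiableWithinAt, by simp, ?_⟩
    rw [contDiffOn_zero]
    exact hs'.congr fun μ hμ => (hs μ hμ).deriv
  have h := fun X => jost_representation hV X hsc h0
    (fun μ hμ => (hre μ hμ).trans (neg_nonpos.2 hδ))
      ((hw X).choose_spec.contDiffOn_expOp_comp hV hI hs hs' hre)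
  exact ⟨differentiable_of_representation (f := fun x μ => jost V (s μ) x) hI hs hs'
      fun X => (h X).1,
    differentiable_of_representation (f := fun x μ => jostD V (s μ) x) hI hs hs'
      fun X => (h X).2⟩

/-- From `2δs ≤ e^{2δs}`: away from the imaginary axis no moment condition is needed. -/
theorem weightBound_of_pos (hV : ∀ X, IntegrableOn V (Ioi X) volume) {δ : ℝ} (hδ : 0 < δ)
    (X : ℝ) : WeightBound V X δ (fun _ => 1 / δ) := by
  refine ⟨hδ.le, monotoneOn_const, fun s hs => ?_, (hV X).norm.const_mul _⟩
  rw [Real.exp_neg, le_div_iff₀ hδ, mul_right_comm, ← div_eq_mul_inv,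
    div_le_one (Real.exp_pos _)]
  have := Real.add_one_le_exp (2 * δ * s)
  linarith

theorem weightBound_zero {X : ℝ} (hVX : IntegrableOn (fun t => (t - X) * ‖V t‖) (Ioi X) volume) :
    WeightBound V X 0 (fun s => 2 * s) := by
  refine ⟨le_rfl, fun s _ t _ hst => by simpa using hst, fun s _ => by simp, ?_⟩
  simpa [mul_assoc] using! hVX.const_mul 2

end

/-! ### Solutions and Wronskians -/

/-- `y` solves `y'' = p y` in the integrated sense, with first derivative `y'`. -/
structure Solves (p y y' : ℝ → ℂ) : Prop where
  prim : IsPrimitive y y'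
  prim' : IsPrimitive y' (fun x => p x * y x)

namespace Solves

variable {p y y' z z' : ℝ → ℂ}

theorem wronskian_eq (hy : Solves p y y') (hz : Solves p z z') (s t : ℝ) :
    y s * z' s - y' s * z s = y t * z' t - y' t * z t := by
  have h := ((hy.prim.mul hz.prim').sub (hy.prim'.mul hz.prim)).congr
    (f₁ := fun x => y x * z' x - y' x * z x) (g₁ := fun _ => 0) (fun _ => rfl) (fun x => by ring)
  exact h.eq_of_zero s t

theorem add (hy : Solves p y y') (hz : Solves p z z') :
    Solves p (fun x => y x + z x) (fun x => y' x + z' x) :=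
  ⟨hy.prim.add hz.prim, (hy.prim'.add hz.prim').congr (fun _ => rfl) fun x => by ring⟩

theorem const_mul (hy : Solves p y y') (c : ℂ) :
    Solves p (fun x => c * y x) (fun x => c * y' x) :=
  ⟨hy.prim.const_mul c, (hy.prim'.const_mul c).congr (fun _ => rfl) fun x => by ring⟩

theorem conj (hy : Solves p y y') (hp : ∀ x, starRingEnd ℂ (p x) = p x) :
    Solves p (fun x => starRingEnd ℂ (y x)) (fun x => starRingEnd ℂ (y' x)) :=
  ⟨hy.prim.conj, hy.prim'.conj.congr (fun _ => rfl) fun x => by rw [map_mul, hp]⟩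

theorem comp_neg (hy : Solves p y y') :
    Solves (fun x => p (-x)) (fun x => y (-x)) (fun x => - y' (-x)) :=
  ⟨hy.prim.comp_neg, hy.prim'.comp_neg.neg.congr (fun _ => rfl) fun x => by ring⟩

theorem congr_left {p₂ : ℝ → ℂ} (hy : Solves p y y') (hp : ∀ x, p x = p₂ x) : Solves p₂ y y' := by
  rwa [← funext hp]

theorem hasDerivAt (hy : Solves p y y') (x : ℝ) : HasDerivAt y (y' x) x :=
  hy.prim.hasDerivAt hy.prim'.continuous x

theorem deriv_eq (hy : Solves p y y') : deriv y = y' := funext fun x => (hy.hasDerivAt x).deriv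

theorem isSolution {q : ℝ → ℝ} {μ : ℂ} (hy : Solves (fun x => q x - μ) y y') :
    IsSolution q μ y := by
  refine ⟨⟨fun x => (hy.hasDerivAt x).differentiableAt, fun α β => ?_⟩, ?_⟩
  · rw [hy.deriv_eq]
    exact hy.prim'.absolutelyContinuous α β
  · filter_upwards [hy.prim'.ae_hasDerivAt] with x hx
    rw [l, hy.deriv_eq, hx.deriv]
    ring

end Solves

theorem solves_jost {V : ℝ → ℂ} {σ : ℂ} (hV : ∀ X, IntegrableOn V (Ioi X) volume)
    (hσ : σ.re ≤ 0) (h0 : σ ≠ 0) :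
    Solves (fun x => σ ^ 2 + V x) (jost V σ) (jostD V σ) :=
  ⟨(jost_isPrimitive hV hσ h0).1, (jost_isPrimitive hV hσ h0).2⟩

/-! ### The initial value problem with locally integrable coefficient -/

section InitialValue

variable {V p : ℝ → ℂ} {σ : ℂ}

theorem integrableOn_Ioi_indicator_Iic (hV : LocallyIntegrable V volume) (X : ℝ) :
    IntegrableOn ((Iic 0).indicator V) (Ioi X) volume := by
  rw [IntegrableOn, integrable_indicator_iff measurableSet_Iic, IntegrableOn,
    Measure.restrict_restrict measurableSet_Iic, inter_comm, Ioi_inter_Iic]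
  exact (hV.integrableOn_isCompact isCompact_Icc).mono_set Ioc_subset_Icc_self

/-- Where the potential vanishes to the right of `x`, both Volterra integrals vanish and the Jost
solution is an exact exponential. -/
theorem jost_indicator_Iic (hV : LocallyIntegrable V volume) (hσ : σ.re ≤ 0) {x : ℝ}
    (hx : 0 ≤ x) :
    jost ((Iic 0).indicator V) σ x = Complex.exp (σ * x) ∧
      jostD ((Iic 0).indicator V) σ x = σ * Complex.exp (σ * x) := by
  have h1 : ∀ t ∈ Ioi x, (Iic 0).indicator V t = 0 := fun t ht =>
    indicator_of_notMem (by simpa using hx.trans_lt ht) V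
  have hR : jostR ((Iic 0).indicator V) σ x = 0 := by
    rw [jostR, volterra]
    exact setIntegral_eq_zero_of_forall_eq_zero fun t ht => by rw [h1 t ht]; ring
  have hP : ∫ t in Ioi x, (Iic 0).indicator V t * jostM ((Iic 0).indicator V) σ t = 0 :=
    setIntegral_eq_zero_of_forall_eq_zero fun t ht => by rw [h1 t ht]; ring
  have hM : jostM ((Iic 0).indicator V) σ x = 1 := by
    rw [jostM_eq (integrableOn_Ioi_indicator_Iic hV) hσ, hR, hP]
    ring
  rw [jost, jostD, hM, hR]
  constructor <;> ring

/-- With the potential switched off on the right half line, every trigonometric function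
extends to a solution. -/
theorem exists_solves_indicator_Iic (hV : LocallyIntegrable V volume) (α β : ℂ) :
    ∃ y y' : ℝ → ℂ, Solves (fun x => -1 + (Iic 0).indicator V x) y y' ∧ ∀ x : ℝ, 0 ≤ x →
      y x = α * Complex.exp (Complex.I * x) + β * Complex.exp (-Complex.I * x) ∧
      y' x = α * (Complex.I * Complex.exp (Complex.I * x)) +
        β * (-Complex.I * Complex.exp (-Complex.I * x)) := by
  have h1 := (solves_jost (σ := Complex.I) (integrableOn_Ioi_indicator_Iic hV) (by simp)
    (by simp)).congr_left (p₂ := fun x => -1 + (Iic 0).indicator V x) (by simp)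
  have h2 := (solves_jost (σ := -Complex.I) (integrableOn_Ioi_indicator_Iic hV) (by simp)
    (by simp)).congr_left (p₂ := fun x => -1 + (Iic 0).indicator V x) (by simp)
  refine ⟨_, _, (h1.const_mul α).add (h2.const_mul β), fun x hx => ?_⟩
  obtain ⟨e1, e2⟩ := jost_indicator_Iic (σ := Complex.I) hV (by simp) hx
  obtain ⟨e3, e4⟩ := jost_indicator_Iic (σ := -Complex.I) hV (by simp) hx
  rw [e1, e2, e3, e4]
  exact ⟨rfl, rfl⟩

theorem locallyIntegrable_comp_neg (hV : LocallyIntegrable V volume) :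
    LocallyIntegrable (fun x => V (-x)) volume := by
  refine locallyIntegrable_of_intervalIntegrable fun x y => ?_
  simpa using (locallyIntegrable_intervalIntegrable hV (-x) (-y)).comp_sub_left 0

/-- Write `p = -1 + V`, so that `σ = ±i` are both admissible. Let `E` be the trigonometric function
with the given data at `0`. A solution `u` for `V` cut off to `x ≤ 0` equals `E` on the right, and
the reflected construction gives `v` equal to `E` on the left; then `u + v - E` is `u` for `x ≤ 0`
and `v` for `x ≥ 0`, and solves the full equation. -/
theorem exists_solves_initial (hp : LocallyIntegrable p volume) (c₀ c₁ : ℂ) :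
    ∃ y y' : ℝ → ℂ, Solves p y y' ∧ y 0 = c₀ ∧ y' 0 = c₁ := by
  have hV : LocallyIntegrable (fun x => p x + 1) volume :=
    hp.add continuous_const.locallyIntegrable
  set α : ℂ := (c₀ - Complex.I * c₁) / 2 with hα
  set β : ℂ := (c₀ + Complex.I * c₁) / 2 with hβ
  obtain ⟨u, u', hu, hu0⟩ := exists_solves_indicator_Iic hV α β
  -- The coefficients are swapped because reflection exchanges `e^{ix}` and `e^{-ix}`.
  obtain ⟨v, v', hv, hv0⟩ := exists_solves_indicator_Iic (locallyIntegrable_comp_neg hV) β α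
  have hv := hv.comp_neg
  have hE := ((isPrimitive_exp Complex.I).const_mul α).add
    ((isPrimitive_exp (-Complex.I)).const_mul β)
  have hE' := (((isPrimitive_exp Complex.I).const_mul Complex.I).const_mul α).add
    (((isPrimitive_exp (-Complex.I)).const_mul (-Complex.I)).const_mul β)
  have hvl : ∀ x : ℝ, x ≤ 0 →
      v (-x) = α * Complex.exp (Complex.I * x) + β * Complex.exp (-Complex.I * x) ∧
      -v' (-x) = α * (Complex.I * Complex.exp (Complex.I * x)) +
        β * (-Complex.I * Complex.exp (-Complex.I * x)) := by
    intro x hx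
    obtain ⟨e1, e2⟩ := hv0 (-x) (by linarith)
    rw [e1, e2]
    push_cast
    simp only [mul_neg, neg_mul, neg_neg]
    constructor <;> ring
  have hI : Complex.I * Complex.I = -1 := Complex.I_mul_I
  refine ⟨_, _, ⟨(hu.prim.add hv.prim).sub hE,
    ((hu.prim'.add hv.prim').sub hE').congr_ae ?_⟩, ?_, ?_⟩
  -- Both cut-off potentials include the point `0`, where `V` would be counted twice.
  · have : ∀ᵐ t : ℝ, t ≠ 0 := by simp [ae_iff, measure_singleton]
    filter_upwards [this] with x hx
    rcases lt_or_gt_of_ne hx with h | h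
    · have h1 : x ∈ Iic (0 : ℝ) := h.le
      have h2 : -x ∉ Iic (0 : ℝ) := by simpa using h
      rw [indicator_of_mem h1, indicator_of_notMem h2, (hvl x h.le).1]
      linear_combination (-(α * Complex.exp (Complex.I * x)) -
        β * Complex.exp (-Complex.I * x)) * hI
    · have h1 : x ∉ Iic (0 : ℝ) := by simpa using h
      have h2 : -x ∈ Iic (0 : ℝ) := by simpa using h.le
      rw [indicator_of_notMem h1, indicator_of_mem h2, (hu0 x h.le).1, neg_neg]
      linear_combination (-(α * Complex.exp (Complex.I * x)) -
        β * Complex.exp (-Complex.I * x)) * hI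
  · have h1 := (hvl 0 le_rfl).1
    have h2 := (hu0 0 le_rfl).1
    simp only [h1, h2]
    simp only [hα, hβ, Complex.ofReal_zero, mul_zero, Complex.exp_zero]
    ring
  · have h1 := (hvl 0 le_rfl).2
    have h2 := (hu0 0 le_rfl).2
    simp only [h1, h2]
    simp only [hα, hβ, Complex.ofReal_zero, mul_zero, Complex.exp_zero]
    linear_combination (-c₁) * hI

end InitialValue

/-! ### The growing solution for `Re σ > 0` -/

/-- A solution of `y'' = p y` asymptotic, with its derivative, to `e^{σx}` at `+∞`. -/
structure IsJostSolution (p : ℝ → ℂ) (σ : ℂ) (y y' : ℝ → ℂ) : Prop where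
  solves : Solves p y y'
  tendsto : Tendsto (fun x : ℝ => Complex.exp (-σ * x) * y x) atTop (𝓝 1)
  tendsto' : Tendsto (fun x : ℝ => Complex.exp (-σ * x) * y' x) atTop (𝓝 σ)

theorem isJostSolution_jost {V : ℝ → ℂ} {σ : ℂ} (hV : ∀ X, IntegrableOn V (Ioi X) volume)
    (hσ : σ.re ≤ 0) (h0 : σ ≠ 0) :
    IsJostSolution (fun x => σ ^ 2 + V x) σ (jost V σ) (jostD V σ) := by
  have he : ∀ x : ℝ, Complex.exp (-σ * x) * Complex.exp (σ * x) = 1 := fun x => by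
    rw [← Complex.exp_add]; simp
  refine ⟨solves_jost hV hσ h0, (tendsto_jostM hV hσ).congr fun x => ?_, ?_⟩
  · rw [jost, ← mul_assoc, he, one_mul]
  · have := ((tendsto_jostM hV hσ).const_mul σ).sub (tendsto_jostR hV hσ)
    simp only [mul_one, sub_zero] at this
    refine this.congr fun x => ?_
    rw [jostD, ← mul_assoc, he, one_mul]

/-- An integrated l'Hôpital rule: if `h' = o(e^{ct})` with `Re c > 0`, then `h = o(e^{ct})`. -/
theorem tendsto_exp_mul_of_deriv {h φ : ℝ → ℂ} {c : ℂ} {X : ℝ} (hc : 0 < c.re)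
    (hd : ∀ t, X ≤ t → HasDerivAt h (Complex.exp (c * t) * φ t) t) (hφ : Tendsto φ atTop (𝓝 0)) :
    Tendsto (fun x : ℝ => Complex.exp (-c * x) * h x) atTop (𝓝 0) := by
  rw [tendsto_zero_iff_norm_tendsto_zero]
  have hexp : ∀ (b : ℂ) (t : ℝ), ‖Complex.exp (b * t)‖ = Real.exp (b.re * t) := fun b t => by
    rw [Complex.norm_exp]; simp
  rw [Metric.tendsto_atTop]
  intro ε hε
  have h1 : ∀ᶠ t in atTop, ‖φ t‖ < c.re * (ε / 2) := by
    have := (tendsto_zero_iff_norm_tendsto_zero.1 hφ).eventually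
      (gt_mem_nhds (show 0 < c.re * (ε / 2) by positivity))
    exact this
  obtain ⟨T, hT⟩ := eventually_atTop.1 (h1.and (eventually_ge_atTop X))
  -- The right side is the integral of the bound `Re c · (ε/2) · e^{Re c · t}` on `‖h'‖`; the factor
  -- `Re c` was put into the smallness of `φ` to cancel here.
  have h2 : ∀ x, T ≤ x → ‖h x‖ ≤ ‖h T‖ + ε / 2 * (Real.exp (c.re * x) - Real.exp (c.re * T)) := by
    intro x hx
    have hB : ∀ t : ℝ, HasDerivAt
        (fun t => ‖h T‖ + ε / 2 * (Real.exp (c.re * t) - Real.exp (c.re * T)))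
        (ε / 2 * (Real.exp (c.re * t) * c.re)) t := fun t => by
      have := ((((hasDerivAt_id t).const_mul c.re).exp.sub_const (Real.exp (c.re * T))).const_mul
        (ε / 2)).const_add ‖h T‖
      simpa using this
    refine image_norm_le_of_norm_deriv_right_le_deriv_boundary (a := T) (b := x)
      (f := h) (f' := fun t => Complex.exp (c * t) * φ t)
      (fun t ht => (hd t (hT t ht.1).2).continuousAt.continuousWithinAt)
      (fun t ht => (hd t (hT t ht.1).2).hasDerivWithinAt) (by simp) hB (fun t ht => ?_)
      (right_mem_Icc.2 hx)
    rw [norm_mul, hexp]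
    calc Real.exp (c.re * t) * ‖φ t‖ ≤ Real.exp (c.re * t) * (c.re * (ε / 2)) := by
          have := (hT t ht.1).1.le
          gcongr
      _ = _ := by ring
  have h3 : Tendsto (fun x : ℝ => Real.exp (-c.re * x) * ‖h T‖) atTop (𝓝 0) := by
    have : Tendsto (fun x : ℝ => -c.re * x) atTop atBot :=
      tendsto_id.const_mul_atTop_of_neg (neg_lt_zero.2 hc)
    simpa using (Real.tendsto_exp_atBot.comp this).mul_const ‖h T‖
  obtain ⟨S, hS⟩ := eventually_atTop.1 (h3.eventually (gt_mem_nhds (half_pos hε)))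
  refine ⟨max S T, fun x hx => ?_⟩
  have h4 := hS x ((le_max_left _ _).trans hx)
  have h5 := h2 x ((le_max_right _ _).trans hx)
  rw [Real.dist_eq, sub_zero, abs_norm, norm_mul, hexp, Complex.neg_re]
  have h6 : Real.exp (-c.re * x) * Real.exp (c.re * x) = 1 := by
    rw [← Real.exp_add]; simp
  have h7 : 0 < Real.exp (-c.re * x) * Real.exp (c.re * T) := by positivity
  calc Real.exp (-c.re * x) * ‖h x‖
      ≤ Real.exp (-c.re * x) *
        (‖h T‖ + ε / 2 * (Real.exp (c.re * x) - Real.exp (c.re * T))) := by gcongr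
    _ = Real.exp (-c.re * x) * ‖h T‖ + ε / 2 * (Real.exp (-c.re * x) * Real.exp (c.re * x)) -
        ε / 2 * (Real.exp (-c.re * x) * Real.exp (c.re * T)) := by ring
    _ < ε := by
      rw [h6]
      nlinarith

/-- A solution whose Wronskian with the decaying Jost solution is `2σ` grows like `e^{σx}`. -/
theorem IsJostSolution.of_wronskian {p y y' z z' : ℝ → ℂ} {σ : ℂ} (hσ : 0 < σ.re)
    (hy : IsJostSolution p (-σ) y y') (hz : Solves p z z')
    (hW : ∀ x, y x * z' x - y' x * z x = 2 * σ) : IsJostSolution p σ z z' := by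
  have hm := hy.tendsto
  have hm' := hy.tendsto'
  simp only [neg_neg] at hm hm'
  set m : ℝ → ℂ := fun x => Complex.exp (σ * x) * y x with hmdef
  have hee : ∀ x : ℝ, Complex.exp (-σ * x) * Complex.exp (σ * x) = 1 := fun x => by
    rw [← Complex.exp_add]; simp
  have hym : ∀ x : ℝ, y x = Complex.exp (-σ * x) * m x := fun x => by
    rw [hmdef]
    simp only
    rw [← mul_assoc, hee, one_mul]
  obtain ⟨X, hX⟩ := eventually_atTop.1 (hm.eventually_ne one_ne_zero)
  have hy0 : ∀ t, X ≤ t → y t ≠ 0 := fun t ht h => hX t ht (by simp [hmdef, h])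
  -- `(z/y)' = 2σ/y²` by the Wronskian, and `y = e^{-σt} m` with `m → 1`; subtracting `e^{2σt}`
  -- leaves a derivative that is `o(e^{2σt})`.
  have hd : ∀ t, X ≤ t → HasDerivAt (fun t : ℝ => z t / y t - Complex.exp (2 * σ * t))
      (Complex.exp (2 * σ * t) * (2 * σ * ((m t)⁻¹ ^ 2 - 1))) t := by
    intro t ht
    have h1 := (hz.hasDerivAt t).div (hy.solves.hasDerivAt t) (hy0 t ht)
    have h2 := ((Complex.ofRealCLM.hasDerivAt (x := t)).const_mul (2 * σ)).cexp
    refine (h1.sub h2).congr_deriv ?_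
    simp only [Complex.ofRealCLM_apply, Complex.ofReal_one, mul_one]
    have h3 : z' t * y t - z t * y' t = 2 * σ := by rw [← hW t]; ring
    have h4 : Complex.exp (2 * σ * t) * (Complex.exp (-σ * t)) ^ 2 = 1 := by
      rw [← Complex.exp_nat_mul, ← Complex.exp_add]
      push_cast
      rw [show 2 * σ * (t : ℂ) + 2 * (-σ * t) = 0 by ring, Complex.exp_zero]
    have h5 := hX t ht
    have h6 := Complex.exp_ne_zero (-σ * t)
    rw [h3, hym t]
    generalize Complex.exp (-σ * t) = e₁ at *
    generalize Complex.exp (2 * σ * t) = e₂ at *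
    field_simp
    linear_combination (-σ) * h4
  have hφ : Tendsto (fun t => 2 * σ * ((m t)⁻¹ ^ 2 - 1)) atTop (𝓝 0) := by
    have := (((hm.inv₀ one_ne_zero).pow 2).sub_const 1).const_mul (2 * σ)
    simpa using this
  have hlim := tendsto_exp_mul_of_deriv (c := 2 * σ) (by simpa using hσ) hd hφ
  have hzlim : Tendsto (fun x : ℝ => Complex.exp (-σ * x) * z x) atTop (𝓝 1) := by
    have h1 := (hlim.add_const 1).mul hm
    rw [zero_add, one_mul] at h1
    refine h1.congr' ?_
    filter_upwards [eventually_ge_atTop X] with x hx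
    have h5 := hX x hx
    have h6 : Complex.exp (-(2 * σ) * x) * Complex.exp (2 * σ * x) = 1 := by
      rw [← Complex.exp_add]; simp
    have h7 : Complex.exp (-(2 * σ) * x) = Complex.exp (-σ * x) * Complex.exp (-σ * x) := by
      rw [← Complex.exp_add]; congr 1; ring
    have h8 := Complex.exp_ne_zero (-σ * x)
    rw [mul_sub, h6, sub_add_cancel, h7, hym x]
    field_simp
  refine ⟨hz, hzlim, ?_⟩
  -- The derivative needs no further integration: solve the Wronskian identity as `z' = (2σ + y'
  -- z)/y`.
  have h1 := ((hm'.mul hzlim).const_add (2 * σ)).div hm one_ne_zero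
  have h2 : (2 * σ + -σ * 1) / 1 = σ := by ring
  rw [h2] at h1
  refine h1.congr' ?_
  filter_upwards [eventually_ge_atTop X] with x hx
  have h5 := hX x hx
  simp only [Pi.div_apply]
  rw [div_eq_iff h5, ← hW x]
  simp only [hmdef]
  linear_combination (-(y x * z' x - y' x * z x)) * hee x

/-- The Wronskian condition fixes `z` only up to multiples of `y`. Taking `(z, z')(0)` proportional
to `(-conj y', conj y)(0)` makes `z conj z'` at `0` a real multiple of `y conj y'`, so the vanishing
of the bracket of `y` with itself passes to `z`. -/
theorem IsJostSolution.exists_growing {p y y' : ℝ → ℂ} {σ : ℂ} (hσ : 0 < σ.re)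
    (hp : LocallyIntegrable p volume) (hy : IsJostSolution p (-σ) y y') :
    ∃ z z' : ℝ → ℂ, IsJostSolution p σ z z' ∧
      (y 0 * starRingEnd ℂ (y' 0) = y' 0 * starRingEnd ℂ (y 0) →
        z 0 * starRingEnd ℂ (z' 0) = z' 0 * starRingEnd ℂ (z 0)) := by
  set u := y 0 with hu
  set v := y' 0 with hv
  set N : ℂ := u * starRingEnd ℂ u + v * starRingEnd ℂ v with hN
  have hNr : N = ((‖u‖ ^ 2 + ‖v‖ ^ 2 : ℝ) : ℂ) := by
    rw [hN, Complex.mul_conj, Complex.mul_conj, Complex.normSq_eq_norm_sq,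
      Complex.normSq_eq_norm_sq]
    push_cast; ring
  have hN0 : N ≠ 0 := by
    intro h0
    rw [hNr] at h0
    have h0 : ‖u‖ ^ 2 + ‖v‖ ^ 2 = 0 := by exact_mod_cast h0
    have hu0 : u = 0 := by
      have : ‖u‖ ^ 2 = 0 := by nlinarith [sq_nonneg ‖u‖, sq_nonneg ‖v‖]
      simpa using this
    have hv0 : v = 0 := by
      have : ‖v‖ ^ 2 = 0 := by nlinarith [sq_nonneg ‖u‖, sq_nonneg ‖v‖]
      simpa using this
    -- If both data of `y` at `0` vanished, its Wronskians with the fundamental system `c`, `s`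
    -- would vanish, forcing `y = 0`, against the asymptotics.
    obtain ⟨c, c', hc, hc0, hc0'⟩ := exists_solves_initial hp 1 0
    obtain ⟨s, s', hs, hs0, hs0'⟩ := exists_solves_initial hp 0 1
    have hzero : ∀ x, y x = 0 := by
      intro x
      have h1 := hy.solves.wronskian_eq hc x 0
      have h2 := hy.solves.wronskian_eq hs x 0
      have h3 := hc.wronskian_eq hs x 0
      rw [← hu, ← hv, hu0, hv0] at h1 h2
      rw [hc0, hc0', hs0, hs0'] at h3
      linear_combination (-y x) * h3 - s x * h1 + c x * h2
    have := hy.tendsto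
    simp only [hzero, mul_zero] at this
    exact zero_ne_one (tendsto_nhds_unique tendsto_const_nhds this)
  obtain ⟨z, z', hz, hz0, hz0'⟩ := exists_solves_initial hp
    (-(2 * σ) * starRingEnd ℂ v / N) (2 * σ * starRingEnd ℂ u / N)
  refine ⟨z, z', hy.of_wronskian hσ hz fun x => ?_, fun h => ?_⟩
  · rw [hy.solves.wronskian_eq hz x 0, hz0, hz0', ← hu, ← hv]
    field_simp
    rw [hN]; ring
  · have hNc : starRingEnd ℂ N = N := by rw [hNr, Complex.conj_ofReal]
    rw [hz0, hz0']
    simp only [map_div₀, map_mul, map_neg, hNc, Complex.conj_conj, map_ofNat]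
    field_simp
    linear_combination (-(σ * starRingEnd ℂ σ)) * h

/-! ### The exponents `iλ_j(μ)` -/

/-- The exponent `i λ_j(μ)`. -/
def expo (a : ℝ) (j : Fin 2) (μ : ℂ) : ℂ := Complex.I * lam a j μ

section Exponent

variable {a : ℝ} {j k : Fin 2} {μ : ℂ}

theorem sqrt_sq (z : ℂ) : Complex.sqrt z ^ 2 = z := by
  simp [Complex.sqrt]

theorem neg_one_pow_sq (j : Fin 2) : ((-1 : ℂ) ^ (j : ℕ)) ^ 2 = 1 := by
  rw [← pow_mul, mul_comm, pow_mul]; simp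

theorem lam_sq : lam a j μ ^ 2 = μ - a := by
  rw [lam, mul_pow, neg_one_pow_sq, sqrt_sq, one_mul]

theorem lam_swap : lam a (1 - j) μ = - lam a j μ := by
  fin_cases j <;> simp [lam]

theorem expo_sq : expo a j μ ^ 2 = a - μ := by
  rw [expo, mul_pow, lam_sq, Complex.I_sq]; ring

theorem expo_swap : expo a (1 - j) μ = - expo a j μ := by
  rw [expo, expo, lam_swap]; ring

theorem expo_ne_zero (h : μ ≠ a) : expo a j μ ≠ 0 := by
  intro h0
  have := expo_sq (a := a) (j := j) (μ := μ)
  rw [h0] at this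
  exact h (sub_eq_zero.1 (by linear_combination this))

open ComplexOrder in
theorem lam_of_lt {μ : ℝ} (h : a < μ) :
    lam a j (μ : ℂ) = (((-1) ^ (j : ℕ) * √(μ - a) : ℝ) : ℂ) := by
  have h1 : ((μ : ℂ) - a) = ((μ - a : ℝ) : ℂ) := by push_cast; ring
  have h2 : (0 : ℂ) ≤ ((μ - a : ℝ) : ℂ) := by
    exact_mod_cast (sub_nonneg.2 h.le)
  rw [lam, h1, Complex.sqrt_of_nonneg h2]
  push_cast [Complex.ofReal_re]
  rfl

open ComplexOrder in
-- The principal root of a negative number is on the positive imaginary axis, so below the threshold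
-- the exponents are real; index `0` decays at `+∞` and index `1` grows.
theorem expo_of_lt {μ : ℝ} (h : μ < a) :
    expo a j (μ : ℂ) = ((-((-1) ^ (j : ℕ) * √(a - μ)) : ℝ) : ℂ) := by
  have h1 : ((μ : ℂ) - a) = -((a - μ : ℝ) : ℂ) := by push_cast; ring
  have h2 : (0 : ℂ) ≤ ((a - μ : ℝ) : ℂ) := by
    exact_mod_cast (sub_nonneg.2 h.le)
  rw [expo, lam, h1, Complex.sqrt_neg_of_nonneg h2, Complex.sqrt_of_nonneg h2, Complex.ofReal_re]
  push_cast
  linear_combination ((-1) ^ (j : ℕ) * ((√(a - μ) : ℝ) : ℂ)) * Complex.I_mul_I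

theorem expo_re_of_gt {μ : ℝ} (h : a < μ) : (expo a j (μ : ℂ)).re = 0 := by
  rw [expo, lam_of_lt h, Complex.re_mul_ofReal]
  simp

end Exponent

/-! ### Asymptotics, linear independence and brackets -/

theorem tendsto_wronskian {F : Filter ℝ} {σ τ c d : ℂ} {y y' z z' : ℝ → ℂ}
    (hy : Tendsto (fun x : ℝ => Complex.exp (-σ * x) * y x) F (𝓝 1))
    (hy' : Tendsto (fun x : ℝ => Complex.exp (-σ * x) * y' x) F (𝓝 c))
    (hz : Tendsto (fun x : ℝ => Complex.exp (-τ * x) * z x) F (𝓝 1))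
    (hz' : Tendsto (fun x : ℝ => Complex.exp (-τ * x) * z' x) F (𝓝 d)) :
    Tendsto (fun x : ℝ => Complex.exp (-(σ + τ) * x) * (y x * z' x - y' x * z x)) F
      (𝓝 (d - c)) := by
  have h := (hy.mul hz').sub (hy'.mul hz)
  rw [one_mul, mul_one] at h
  refine h.congr fun x => ?_
  have : Complex.exp (-(σ + τ) * x) = Complex.exp (-σ * x) * Complex.exp (-τ * x) := by
    rw [← Complex.exp_add]; congr 1; ring
  rw [this]; ring

theorem isEquivalent_const_mul_exp {F : Filter ℝ} {σ c : ℂ} {f : ℝ → ℂ} (hc : c ≠ 0)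
    (h : Tendsto (fun x : ℝ => Complex.exp (-σ * x) * f x) F (𝓝 c)) :
    f ~[F] fun x : ℝ => c * Complex.exp (σ * x) := by
  refine (isEquivalent_iff_tendsto_one (Eventually.of_forall fun x =>
    mul_ne_zero hc (Complex.exp_ne_zero _))).2 ?_
  have h1 := h.div_const c
  rw [div_self hc] at h1
  refine h1.congr fun x => ?_
  have h2 : Complex.exp (-σ * x) = (Complex.exp (σ * x))⁻¹ := by
    rw [← Complex.exp_neg]; congr 1; ring
  have h3 := Complex.exp_ne_zero (σ * x)
  simp only [Pi.div_apply, h2]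
  field_simp

/-- Since `|e^{-2σt}| ≥ 1` for `t ≥ 0`, the constant `w` cannot be damped. Equality `Re σ = 0` is
allowed, which covers `μ > a`. -/
theorem eq_zero_of_tendsto_exp_mul {σ w : ℂ} (hσ : σ.re ≤ 0)
    (h : Tendsto (fun t : ℝ => Complex.exp (-(σ + σ) * t) * w) atTop (𝓝 0)) : w = 0 := by
  rw [tendsto_zero_iff_norm_tendsto_zero] at h
  refine norm_le_zero_iff.1 (ge_of_tendsto h ?_)
  filter_upwards [eventually_ge_atTop 0] with t ht
  rw [norm_mul, Complex.norm_exp]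
  refine le_mul_of_one_le_left (norm_nonneg _) (Real.one_le_exp ?_)
  have : (-(σ + σ) * (t : ℂ)).re = -2 * σ.re * t := by simp; ring
  rw [this]
  nlinarith

/-- Solutions `y_j` with derivatives `D_j` that are asymptotic to `e^{iλ_j x}` along `F`. -/
structure JostFamily (q : ℝ → ℝ) (a : ℝ) (F : Filter ℝ) (y D : Fin 2 → ℝ → ℂ → ℂ) : Prop where
  solves : ∀ (μ : ℂ), μ ≠ a → ∀ j,
    Solves (fun x => q x - μ) (fun x => y j x μ) (fun x => D j x μ)
  tendsto : ∀ (μ : ℂ), μ ≠ a → ∀ j,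
    Tendsto (fun x : ℝ => Complex.exp (-expo a j μ * x) * y j x μ) F (𝓝 1)
  tendsto' : ∀ (μ : ℂ), μ ≠ a → ∀ j,
    Tendsto (fun x : ℝ => Complex.exp (-expo a j μ * x) * D j x μ) F (𝓝 (expo a j μ))

theorem eq_one_sub_of_ne : ∀ j k : Fin 2, j ≠ k → k = 1 - j := by decide

namespace JostFamily

variable {q : ℝ → ℝ} {a : ℝ} {F : Filter ℝ} {y D : Fin 2 → ℝ → ℂ → ℂ} {μ : ℂ}

theorem dx_eq (h : JostFamily q a F y D) (hμ : μ ≠ a) (j : Fin 2) (x : ℝ) :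
    dx (y j) x μ = D j x μ :=
  congrFun (h.solves μ hμ j).deriv_eq x

theorem isJostPair [F.NeBot] (h : JostFamily q a F y D) (hμ : μ ≠ a) : IsJostPair q a F y μ := by
  refine ⟨fun j => (h.solves μ hμ j).isSolution, ?_, fun j => ⟨?_, ?_⟩⟩
  -- The two exponents are opposite and nonzero, so the Wronskian has a nonzero limit and is nonzero
  -- at some point; this rules out a linear relation.
  · have hW := tendsto_wronskian (h.tendsto μ hμ 0) (h.tendsto' μ hμ 0) (h.tendsto μ hμ 1)
      (h.tendsto' μ hμ 1)
    have hs : expo a 1 μ = - expo a 0 μ := expo_swap (j := 0)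
    have hne : expo a 1 μ - expo a 0 μ ≠ 0 := by
      rw [hs]
      intro h0
      exact expo_ne_zero (j := 0) hμ (by linear_combination (-1 / 2 : ℂ) * h0)
    obtain ⟨x, hx⟩ := (hW.eventually_ne hne).exists
    have hx := right_ne_zero_of_mul hx
    rw [Fintype.linearIndependent_iff]
    intro c hc
    simp only [Fin.sum_univ_two] at hc
    have h0 : ∀ t, c 0 * y 0 t μ + c 1 * y 1 t μ = 0 := fun t => by
      simpa using congrFun hc t
    have h1 : c 0 * D 0 x μ + c 1 * D 1 x μ = 0 := by
      have hd := (((h.solves μ hμ 0).const_mul (c 0)).add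
        ((h.solves μ hμ 1).const_mul (c 1))).hasDerivAt x
      simp only [h0] at hd
      exact hd.unique (hasDerivAt_const x 0)
    have hc0 : c 0 = 0 := by
      refine (mul_eq_zero.1 ?_).resolve_right hx
      linear_combination D 1 x μ * h0 x - y 1 x μ * h1
    have hc1 : c 1 = 0 := by
      refine (mul_eq_zero.1 ?_).resolve_right hx
      linear_combination y 0 x μ * h1 - D 0 x μ * h0 x
    intro i
    fin_cases i
    · exact hc0
    · exact hc1
  · have := isEquivalent_const_mul_exp one_ne_zero (h.tendsto μ hμ j)
    refine this.congr_right (Eventually.of_forall fun x => ?_)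
    simp only
    rw [one_mul, expo]
    congr 1; ring
  · have := isEquivalent_const_mul_exp (expo_ne_zero hμ) (h.tendsto' μ hμ j)
    have h2 : (fun x : ℝ => dx (y j) x μ) = fun x => D j x μ := funext fun x => h.dx_eq hμ j x
    rw [h2]
    refine this.congr_right (Eventually.of_forall fun x => ?_)
    simp only
    rw [expo]
    congr 2; ring

/-- The reflection `x ↦ -x` exchanges the two ends of the line. -/
theorem reflect (h : JostFamily (fun x => q (-x)) a atTop y D) :
    JostFamily q a atBot (fun j x μ => y (1 - j) (-x) μ) (fun j x μ => - D (1 - j) (-x) μ) := by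
  refine ⟨fun μ hμ j => ?_, fun μ hμ j => ?_, fun μ hμ j => ?_⟩
  · exact (h.solves μ hμ (1 - j)).comp_neg.congr_left fun x => by rw [neg_neg]
  · refine ((h.tendsto μ hμ (1 - j)).comp tendsto_neg_atBot_atTop).congr fun x => ?_
    simp [expo_swap]
  · have := ((h.tendsto' μ hμ (1 - j)).comp tendsto_neg_atBot_atTop).neg
    rw [expo_swap, neg_neg] at this
    refine this.congr fun x => ?_
    simp

/-- For real `μ`, `i` times the Wronskian of `y_j` with the conjugate of `y_k` is the bracket, and
it is constant. If `λ_j = conj λ_k`, the exponentials cancel and the limit gives the value.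
Otherwise its product with `e^{-2σ_j x}` tends to zero, so it vanishes when `Re σ_j ≤ 0`. The
exception is `j = k` growing with `μ < a`, supplied by `hreal`. -/
theorem bracketRelations (h : JostFamily q a atTop y D) {μ : ℝ} (hμ : (μ : ℂ) ≠ a)
    (hreal : μ < a → y 1 0 μ * starRingEnd ℂ (D 1 0 μ) = D 1 0 μ * starRingEnd ℂ (y 1 0 μ)) :
    BracketRelations a y μ := by
  intro j k x
  have hd : ∀ i, deriv (fun t => y i t μ) = fun t => D i t μ := fun i =>
    (h.solves μ hμ i).deriv_eq
  simp only [bracket, hd]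
  have hconj : Solves (fun x => q x - (μ : ℂ)) (fun x => starRingEnd ℂ (y k x μ))
      (fun x => starRingEnd ℂ (D k x μ)) := (h.solves μ hμ k).conj fun x => by simp
  set w : ℝ → ℂ := fun x => y j x μ * starRingEnd ℂ (D k x μ) - D j x μ * starRingEnd ℂ (y k x μ)
    with hw
  have hconst : ∀ s t, w s = w t := (h.solves μ hμ j).wronskian_eq hconj
  have hcexp : ∀ x : ℝ, starRingEnd ℂ (Complex.exp (-expo a k μ * x)) =
      Complex.exp (-starRingEnd ℂ (expo a k μ) * x) := fun x => by
    rw [← Complex.exp_conj]; simp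
  have h1 := (Complex.continuous_conj.tendsto _).comp (h.tendsto μ hμ k)
  have h2 := (Complex.continuous_conj.tendsto _).comp (h.tendsto' μ hμ k)
  simp only [Function.comp_def, map_mul, hcexp, map_one] at h1 h2
  have hlim := tendsto_wronskian (h.tendsto μ hμ j) (h.tendsto' μ hμ j) h1 h2
  change Tendsto (fun x : ℝ => _ * w x) _ _ at hlim
  simp only [fun t => hconst t x] at hlim
  have hck : starRingEnd ℂ (expo a k μ) = -(Complex.I * starRingEnd ℂ (lam a k μ)) := by
    rw [expo, map_mul, Complex.conj_I]; ring
  refine ⟨fun hl => ?_, fun hl => ?_⟩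
  · change Complex.I * w x = _
    rw [hck, ← hl, expo] at hlim
    have h3 := tendsto_nhds_unique hlim
      ((tendsto_const_nhds (x := w x)).congr fun t => by simp)
    rw [← h3]
    linear_combination (-2 * lam a j μ) * Complex.I_mul_I
  · change Complex.I * w x = _
    suffices hwx : w x = 0 by rw [hwx, mul_zero]
    have hne : μ ≠ a := fun h => hμ (by rw [h])
    rcases lt_or_gt_of_ne hne with hlt | hgt
    · have hr : ∀ i, starRingEnd ℂ (expo a i μ) = expo a i μ := fun i => by
        rw [expo_of_lt hlt, Complex.conj_ofReal]
      have hjk : j = k := by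
        by_contra hjk
        have hk : k = 1 - j := eq_one_sub_of_ne j k hjk
        apply hl
        have := hr k
        rw [hck] at this
        have h5 : expo a k μ = - expo a j μ := by rw [hk, expo_swap]
        rw [h5, expo] at this
        have := mul_left_cancel₀ (neg_ne_zero.2 Complex.I_ne_zero)
          (show -Complex.I * starRingEnd ℂ (lam a k μ) = -Complex.I * lam a j μ by
            linear_combination this)
        exact this.symm
      subst hjk
      rw [hr j, sub_self] at hlim
      obtain rfl | rfl := Fin.exists_fin_two.1 ⟨j, rfl⟩
      · exact eq_zero_of_tendsto_exp_mul (by rw [expo_of_lt hlt]; simp) hlim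
      · rw [hconst x 0]
        exact sub_eq_zero.2 (hreal hlt)
    · have hr : ∀ i, starRingEnd ℂ (lam a i μ) = lam a i μ := fun i => by
        rw [lam_of_lt hgt, Complex.conj_ofReal]
      have hjk : j ≠ k := fun hjk => hl (by rw [hjk, hr k])
      have hk : k = 1 - j := eq_one_sub_of_ne j k hjk
      rw [hck, hr k, hk, lam_swap] at hlim
      refine eq_zero_of_tendsto_exp_mul (σ := expo a j μ) (expo_re_of_gt hgt).le ?_
      simpa [expo] using hlim

end JostFamily

/-- Reflection changes the sign of the bracket, and swapping the indices changes the sign of `λ`;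
the two cancel. -/
theorem BracketRelations.reflect {a : ℝ} {y : Fin 2 → ℝ → ℂ → ℂ} {μ : ℂ}
    (h : BracketRelations a y μ) : BracketRelations a (fun j x μ => y (1 - j) (-x) μ) μ := by
  intro j k x
  have hb : bracket (fun t => y (1 - j) (-t) μ) (fun t => y (1 - k) (-t) μ) x =
      - bracket (fun t => y (1 - j) t μ) (fun t => y (1 - k) t μ) (-x) := by
    have hd : ∀ i, deriv (fun t => y i (-t) μ) x = - deriv (fun t => y i t μ) (-x) := fun i =>
      deriv_comp_neg (fun t => y i t μ) x
    simp only [bracket, hd, map_neg]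
    ring
  have hh := h (1 - j) (1 - k) (-x)
  rw [lam_swap, lam_swap, map_neg] at hh
  refine ⟨fun hl => ?_, fun hl => ?_⟩
  · rw [hb, hh.1 (by rw [hl])]; ring
  · rw [hb, hh.2 (fun h => hl (neg_injective h)), neg_zero]

/-! ### Construction and regularity at the right end -/

/-- The potential relative to its limit `a`, as a complex function. -/
def shifted (q : ℝ → ℝ) (a : ℝ) (x : ℝ) : ℂ := ((q x - a : ℝ) : ℂ)

/-- The case split is on the sign of `Re iλ_j`, not on `j`, because for non-real `μ` either index
can be the decaying one. The last two clauses retain what the asymptotics do not determine: the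
identity with `jost` for regularity, and the condition at `0` for the brackets. -/
theorem exists_jostSolution {q : ℝ → ℝ} {a : ℝ}
    (hV : ∀ X, IntegrableOn (shifted q a) (Ioi X) volume) {μ : ℂ} (hμ : μ ≠ a) (j : Fin 2) :
    ∃ z : (ℝ → ℂ) × (ℝ → ℂ), IsJostSolution (fun x => q x - μ) (expo a j μ) z.1 z.2 ∧
      ((expo a j μ).re ≤ 0 →
        z = (jost (shifted q a) (expo a j μ), jostD (shifted q a) (expo a j μ))) ∧
      (0 < (expo a j μ).re →
        (jost (shifted q a) (-expo a j μ) 0 * starRingEnd ℂ (jostD (shifted q a) (-expo a j μ) 0) =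
          jostD (shifted q a) (-expo a j μ) 0 *
            starRingEnd ℂ (jost (shifted q a) (-expo a j μ) 0)) →
        z.1 0 * starRingEnd ℂ (z.2 0) = z.2 0 * starRingEnd ℂ (z.1 0)) := by
  have hp : ∀ i, (fun x => expo a i μ ^ 2 + shifted q a x) = fun x => (q x - μ : ℂ) := fun i => by
    funext x
    rw [expo_sq, shifted]
    push_cast; ring
  by_cases hre : (expo a j μ).re ≤ 0
  · have h := isJostSolution_jost hV hre (expo_ne_zero hμ)
    rw [hp] at h
    exact ⟨_, h, fun _ => rfl, fun h => absurd h hre.not_gt⟩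
  · have hre := not_le.1 hre
    have h := isJostSolution_jost (σ := expo a (1 - j) μ) hV
      (by rw [expo_swap]; simpa using hre.le) (expo_ne_zero hμ)
    rw [hp, expo_swap] at h
    have hloc : LocallyIntegrable (fun x => (q x - μ : ℂ)) volume := by
      rw [← hp j]
      refine LocallyIntegrable.add continuous_const.locallyIntegrable ?_
      exact locallyIntegrable_of_intervalIntegrable fun x y =>
        intervalIntegrable_iff.2 ((hV (min x y)).mono_set fun t ht => ht.1)
    obtain ⟨z, z', hz, hz'⟩ := h.exists_growing hre hloc
    exact ⟨(z, z'), hz, fun h => absurd h hre.not_ge, fun _ => hz'⟩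

/-- The derivative in the parameter exists and is continuous if it does locally. -/
theorem ContDiffInParam.of_local {y : ℝ → ℂ → ℂ} {I : Set ℝ}
    (h : ∀ μ ∈ I, ∃ J, IsOpen J ∧ μ ∈ J ∧ ContDiffInParam y J) : ContDiffInParam y I := by
  refine ⟨fun x μ hμ => ?_, ?_⟩
  · obtain ⟨J, _, hJ, hd, _⟩ := h μ hμ
    exact hd x μ hJ
  · rintro ⟨x, μ⟩ hp
    obtain ⟨J, hJo, hJ, _, hc⟩ := h μ hp.2
    exact (hc.continuousAt (prod_mem_nhds univ_mem (hJo.mem_nhds hJ))).continuousWithinAt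

theorem ContDiffInParam.mono {y : ℝ → ℂ → ℂ} {I J : Set ℝ} (h : ContDiffInParam y J)
    (hIJ : I ⊆ J) : ContDiffInParam y I :=
  ⟨fun x μ hμ => h.1 x μ (hIJ hμ), h.2.mono (prod_mono_right hIJ)⟩

theorem JointlyContinuous.mono {y : ℝ → ℂ → ℂ} {I J : Set ℝ} (h : JointlyContinuous y J)
    (hIJ : I ⊆ J) : JointlyContinuous y I :=
  ContinuousOn.mono h (prod_mono_right hIJ)

theorem ContDiffInParam.congr {y : ℝ → ℂ → ℂ} {f : ℝ → ℝ → ℂ} {I : Set ℝ} (hI : IsOpen I)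
    (he : ∀ x, ∀ μ ∈ I, y x (μ : ℂ) = f x μ)
    (hd : ∀ x, ∀ μ ∈ I, DifferentiableAt ℝ (f x) μ)
    (hc : ContinuousOn (fun p : ℝ × ℝ => deriv (f p.1) p.2) (univ ×ˢ I)) :
    ContDiffInParam y I := by
  have hee : ∀ x, ∀ μ ∈ I, (fun m : ℝ => y x m) =ᶠ[𝓝 μ] f x := fun x μ hμ => by
    filter_upwards [hI.mem_nhds hμ] with ν hν using he x ν hν
  exact ⟨fun x μ hμ => (hd x μ hμ).congr_of_eventuallyEq (hee x μ hμ),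
    hc.congr fun p hp => (hee p.1 p.2 hp.2).deriv_eq⟩

/-- Regularity of a family of solutions in the spectral parameter; `i` is the index of the
solution that decays below the threshold `a`, and `M` is the moment condition. -/
structure ParamRegular (a : ℝ) (i : Fin 2) (M : Prop) (y : Fin 2 → ℝ → ℂ → ℂ) : Prop where
  cont_above : ∀ j, JointlyContinuous (y j) (Ioi a) ∧ JointlyContinuous (dx (y j)) (Ioi a)
  cont_below : JointlyContinuous (y i) (Iio a) ∧ JointlyContinuous (dx (y i)) (Iio a)
  diff_below : ContDiffInParam (y i) (Iio a) ∧ ContDiffInParam (dx (y i)) (Iio a)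
  diff_above : M → ∀ j, ContDiffInParam (y j) (Ioi a) ∧ ContDiffInParam (dx (y j)) (Ioi a)

theorem dx_reflect (y : ℝ → ℂ → ℂ) : dx (fun x μ => y (-x) μ) = fun x μ => - dx y (-x) μ := by
  funext x μ
  exact deriv_comp_neg (fun t => y t μ) x

theorem JointlyContinuous.reflect {y : ℝ → ℂ → ℂ} {I : Set ℝ} (h : JointlyContinuous y I) :
    JointlyContinuous (fun x μ => y (-x) μ) I :=
  ContinuousOn.comp (g := fun p : ℝ × ℝ => y p.1 (p.2 : ℂ)) (f := fun p : ℝ × ℝ => (-p.1, p.2)) h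
    (by fun_prop) fun _ hp => ⟨trivial, hp.2⟩

theorem ContDiffInParam.reflect {y : ℝ → ℂ → ℂ} {I : Set ℝ} (h : ContDiffInParam y I) :
    ContDiffInParam (fun x μ => y (-x) μ) I :=
  ⟨fun x μ hμ => h.1 (-x) μ hμ,
    ContinuousOn.comp (g := fun p : ℝ × ℝ => deriv (fun m : ℝ => y p.1 (m : ℂ)) p.2)
      (f := fun p : ℝ × ℝ => (-p.1, p.2)) h.2 (by fun_prop) fun _ hp => ⟨trivial, hp.2⟩⟩

theorem ContDiffInParam.neg {y : ℝ → ℂ → ℂ} {I : Set ℝ} (h : ContDiffInParam y I) :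
    ContDiffInParam (fun x μ => - y x μ) I := by
  refine ⟨fun x μ hμ => (h.1 x μ hμ).neg, h.2.neg.congr fun p _ => ?_⟩
  exact deriv.fun_neg

theorem ParamRegular.reflect {a : ℝ} {M : Prop} {y : Fin 2 → ℝ → ℂ → ℂ}
    (h : ParamRegular a 0 M y) : ParamRegular a 1 M (fun j x μ => y (1 - j) (-x) μ) := by
  have hc : ∀ {j : Fin 2} {I : Set ℝ},
      JointlyContinuous (y j) I ∧ JointlyContinuous (dx (y j)) I →
      JointlyContinuous (fun x μ => y j (-x) μ) I ∧
        JointlyContinuous (dx (fun x μ => y j (-x) μ)) I := fun {j I} h => by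
    refine ⟨h.1.reflect, ?_⟩
    rw [dx_reflect]
    exact ContinuousOn.neg h.2.reflect
  have hd : ∀ {j : Fin 2} {I : Set ℝ},
      ContDiffInParam (y j) I ∧ ContDiffInParam (dx (y j)) I →
      ContDiffInParam (fun x μ => y j (-x) μ) I ∧
        ContDiffInParam (dx (fun x μ => y j (-x) μ)) I := fun {j I} h => by
    refine ⟨h.1.reflect, ?_⟩
    rw [dx_reflect]
    exact h.2.reflect.neg
  exact ⟨fun j => hc (h.cont_above _), hc h.cont_below, hd h.diff_below,
    fun hM j => hd (h.diff_above hM _)⟩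

section Regularity

variable {q : ℝ → ℝ} {a : ℝ} {y D : Fin 2 → ℝ → ℂ → ℂ}

theorem hasDerivAt_expo_above {μ : ℝ} (hμ : a < μ) (j : Fin 2) :
    HasDerivAt (fun μ : ℝ => expo a j μ)
      (Complex.I * (((-1) ^ (j : ℕ) * (1 / (2 * √(μ - a))) : ℝ) : ℂ)) μ := by
  have h1 : HasDerivAt (fun μ : ℝ => (-1) ^ (j : ℕ) * √(μ - a))
      ((-1) ^ (j : ℕ) * (1 / (2 * √(μ - a)))) μ :=
    (((hasDerivAt_id μ).sub_const a).sqrt (sub_pos.2 hμ).ne').const_mul _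
  refine (h1.ofReal_comp.const_mul Complex.I).congr_of_eventuallyEq ?_
  filter_upwards [lt_mem_nhds hμ] with ν hν
  rw [expo, lam_of_lt hν]

theorem hasDerivAt_expo_below {μ : ℝ} (hμ : μ < a) :
    HasDerivAt (fun μ : ℝ => expo a 0 μ) ((1 / (2 * √(a - μ)) : ℝ) : ℂ) μ := by
  have h1 : HasDerivAt (fun μ : ℝ => -√(a - μ)) (1 / (2 * √(a - μ))) μ :=
    (((hasDerivAt_id μ).const_sub a).sqrt (sub_pos.2 hμ).ne').neg.congr_deriv (by simp; ring)
  refine h1.ofReal_comp.congr_of_eventuallyEq ?_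
  filter_upwards [gt_mem_nhds hμ] with ν hν
  rw [expo_of_lt hν]
  simp

theorem paramRegular_of_jost (hV : ∀ X, IntegrableOn (shifted q a) (Ioi X) volume)
    (hF : JostFamily q a atTop y D)
    (hj : ∀ (μ : ℂ), μ ≠ a → ∀ j, (expo a j μ).re ≤ 0 → ∀ x,
      y j x μ = jost (shifted q a) (expo a j μ) x ∧
      D j x μ = jostD (shifted q a) (expo a j μ) x) :
    ParamRegular a 0
      (∀ X, IntegrableOn (fun t => (t - X) * ‖shifted q a t‖) (Ioi X) volume) y := by
  have hne_above : ∀ μ ∈ Ioi a, ((μ : ℝ) : ℂ) ≠ a := fun μ hμ => by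
    exact_mod_cast (ne_of_gt hμ)
  have hne_below : ∀ μ ∈ Iio a, ((μ : ℝ) : ℂ) ≠ a := fun μ hμ => by
    exact_mod_cast (ne_of_lt hμ)
  have hre_below : ∀ μ ∈ Iio a, (expo a 0 ((μ : ℝ) : ℂ)).re = -√(a - μ) := fun μ hμ => by
    rw [expo_of_lt hμ, Complex.ofReal_re]; simp
  have hre_below' : ∀ μ ∈ Iio a, (expo a 0 ((μ : ℝ) : ℂ)).re ≤ 0 := fun μ hμ => by
    rw [hre_below μ hμ]; simp
  have hy_above : ∀ j x, ∀ μ ∈ Ioi a, y j x ((μ : ℝ) : ℂ) = jost (shifted q a) (expo a j μ) x :=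
    fun j x μ hμ => (hj μ (hne_above μ hμ) j (expo_re_of_gt hμ).le x).1
  have hD_above : ∀ j x, ∀ μ ∈ Ioi a,
      dx (y j) x ((μ : ℝ) : ℂ) = jostD (shifted q a) (expo a j μ) x := fun j x μ hμ => by
    rw [hF.dx_eq (hne_above μ hμ)]
    exact (hj μ (hne_above μ hμ) j (expo_re_of_gt hμ).le x).2
  have hy_below : ∀ x, ∀ μ ∈ Iio a, y 0 x ((μ : ℝ) : ℂ) = jost (shifted q a) (expo a 0 μ) x :=
    fun x μ hμ => (hj μ (hne_below μ hμ) 0 (hre_below' μ hμ) x).1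
  have hD_below : ∀ x, ∀ μ ∈ Iio a,
      dx (y 0) x ((μ : ℝ) : ℂ) = jostD (shifted q a) (expo a 0 μ) x := fun x μ hμ => by
    rw [hF.dx_eq (hne_below μ hμ)]
    exact (hj μ (hne_below μ hμ) 0 (hre_below' μ hμ) x).2
  refine ⟨fun j => ?_, ?_, ?_, fun hM j => ?_⟩
  · have hs : ContinuousOn (fun μ : ℝ => expo a j μ) (Ioi a) := fun μ hμ =>
      (hasDerivAt_expo_above hμ j).continuousAt.continuousWithinAt
    obtain ⟨h1, h2⟩ := continuousOn_jost hV hs (fun μ hμ => expo_ne_zero (hne_above μ hμ))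
      (fun μ hμ => (expo_re_of_gt hμ).le)
    exact ⟨h1.congr fun p hp => hy_above j p.1 p.2 hp.2,
      h2.congr fun p hp => hD_above j p.1 p.2 hp.2⟩
  · have hs : ContinuousOn (fun μ : ℝ => expo a 0 μ) (Iio a) := fun μ hμ =>
      (hasDerivAt_expo_below hμ).continuousAt.continuousWithinAt
    obtain ⟨h1, h2⟩ := continuousOn_jost hV hs (fun μ hμ => expo_ne_zero (hne_below μ hμ))
      hre_below'
    exact ⟨h1.congr fun p hp => hy_below p.1 p.2 hp.2,
      h2.congr fun p hp => hD_below p.1 p.2 hp.2⟩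
  · have key : ∀ μ ∈ Iio a, ∃ J, IsOpen J ∧ μ ∈ J ∧ ContDiffInParam (y 0) J ∧
        ContDiffInParam (dx (y 0)) J := by
      intro μ hμ
      have hμ' : μ < a := hμ
      -- On `(-∞, c)` the exponent stays to the left of `-√(a - c) < 0`, so a constant weight works;
      -- such half-lines exhaust `(-∞, a)`.
      set c : ℝ := (μ + a) / 2 with hc
      have hca : c < a := by rw [hc]; linarith
      have hsub : ∀ ν ∈ Iio c, ν ∈ Iio a := fun ν hν => lt_trans hν hca
      have hs' : ContinuousOn (fun μ : ℝ => ((1 / (2 * √(a - μ)) : ℝ) : ℂ)) (Iio c) := by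
        refine Complex.continuous_ofReal.comp_continuousOn (continuousOn_const.div (by fun_prop) ?_)
        intro ν hν
        have : 0 < √(a - ν) := Real.sqrt_pos.2 (sub_pos.2 (hsub ν hν))
        positivity
      obtain ⟨⟨h1, h2⟩, h3, h4⟩ := differentiable_jost (δ := √(a - c)) hV isOpen_Iio
        (fun ν hν => hasDerivAt_expo_below (hsub ν hν)) hs'
        (fun ν hν => expo_ne_zero (hne_below ν (hsub ν hν)))
        (fun ν hν => by
          rw [hre_below ν (hsub ν hν)]
          exact neg_le_neg (Real.sqrt_le_sqrt (by have : ν < c := hν; linarith)))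
        (fun X => ⟨_, weightBound_of_pos hV (Real.sqrt_pos.2 (sub_pos.2 hca)) X⟩)
      refine ⟨Iio c, isOpen_Iio, by rw [mem_Iio, hc]; linarith,
        ContDiffInParam.congr isOpen_Iio (fun x ν hν => hy_below x ν (hsub ν hν)) h1 h2,
        ContDiffInParam.congr isOpen_Iio (fun x ν hν => hD_below x ν (hsub ν hν)) h3 h4⟩
    exact ⟨.of_local fun μ hμ => (key μ hμ).imp fun J h => ⟨h.1, h.2.1, h.2.2.1⟩,
      .of_local fun μ hμ => (key μ hμ).imp fun J h => ⟨h.1, h.2.1, h.2.2.2⟩⟩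
  · have hs' : ContinuousOn (fun μ : ℝ =>
        Complex.I * (((-1) ^ (j : ℕ) * (1 / (2 * √(μ - a))) : ℝ) : ℂ)) (Ioi a) := by
      refine continuousOn_const.mul (Complex.continuous_ofReal.comp_continuousOn
        (continuousOn_const.mul (continuousOn_const.div (by fun_prop) ?_)))
      intro ν hν
      have : 0 < √(ν - a) := Real.sqrt_pos.2 (sub_pos.2 hν)
      positivity
    obtain ⟨⟨h1, h2⟩, h3, h4⟩ := differentiable_jost (δ := 0) hV isOpen_Ioi
      (fun ν hν => hasDerivAt_expo_above hν j) hs'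
      (fun ν hν => expo_ne_zero (hne_above ν hν))
      (fun ν hν => by rw [expo_re_of_gt hν]; simp)
      (fun X => ⟨_, weightBound_zero (hM X)⟩)
    exact ⟨.congr isOpen_Ioi (hy_above j) h1 h2, .congr isOpen_Ioi (hD_above j) h3 h4⟩

end Regularity

/-- The solutions attached to the right end of the line. -/
theorem exists_jostFamily {q : ℝ → ℝ} {a : ℝ}
    (hV : ∀ X, IntegrableOn (shifted q a) (Ioi X) volume) :
    ∃ y D : Fin 2 → ℝ → ℂ → ℂ, JostFamily q a atTop y D ∧
      (∀ μ : ℝ, μ ≠ a → BracketRelations a y μ) ∧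
      ParamRegular a 0
        (∀ X, IntegrableOn (fun t => (t - X) * ‖shifted q a t‖) (Ioi X) volume) y := by
  classical
  have hex := fun (μ : ℂ) (hμ : μ ≠ a) (j : Fin 2) => exists_jostSolution hV hμ j
  choose z hz hz_jost hz_real using hex
  -- The value `0` at `μ = a` is arbitrary.
  let y : Fin 2 → ℝ → ℂ → ℂ := fun j x μ => if h : μ ≠ a then (z μ h j).1 x else 0
  let D : Fin 2 → ℝ → ℂ → ℂ := fun j x μ => if h : μ ≠ a then (z μ h j).2 x else 0
  have hy : ∀ (μ : ℂ) (h : μ ≠ a) j, (fun x => y j x μ) = (z μ h j).1 := fun μ h j => by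
    funext x
    simp only [y, dif_pos h]
  have hD : ∀ (μ : ℂ) (h : μ ≠ a) j, (fun x => D j x μ) = (z μ h j).2 := fun μ h j => by
    funext x
    simp only [D, dif_pos h]
  have hyx : ∀ (μ : ℂ) (h : μ ≠ a) j x, y j x μ = (z μ h j).1 x := fun μ h j x => congrFun (hy μ h j) x
  have hDx : ∀ (μ : ℂ) (h : μ ≠ a) j x, D j x μ = (z μ h j).2 x := fun μ h j x => congrFun (hD μ h j) x
  have hF : JostFamily q a atTop y D := by
    refine ⟨fun μ hμ j => ?_, fun μ hμ j => ?_, fun μ hμ j => ?_⟩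
    · rw [hy μ hμ, hD μ hμ]
      exact (hz μ hμ j).solves
    · simp only [hyx μ hμ]
      exact (hz μ hμ j).tendsto
    · simp only [hDx μ hμ]
      exact (hz μ hμ j).tendsto'
  have hjost : ∀ (μ : ℂ), μ ≠ a → ∀ j, (expo a j μ).re ≤ 0 → ∀ x,
      y j x μ = jost (shifted q a) (expo a j μ) x ∧
      D j x μ = jostD (shifted q a) (expo a j μ) x := by
    intro μ hμ j hre x
    rw [hyx μ hμ, hDx μ hμ, hz_jost μ hμ j hre]
    exact ⟨rfl, rfl⟩
  refine ⟨y, D, hF, fun μ hμ => ?_, paramRegular_of_jost hV hF hjost⟩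
  have hμc : (μ : ℂ) ≠ a := by exact_mod_cast hμ
  refine hF.bracketRelations hμc fun hlt => ?_
  have hs : - expo a 1 (μ : ℂ) = expo a 0 μ := by
    rw [← expo_swap]; rfl
  have hre0 : (expo a 0 (μ : ℂ)).re ≤ 0 := by
    rw [expo_of_lt hlt, Complex.ofReal_re]; simp
  have hre1 : 0 < (expo a 1 (μ : ℂ)).re := by
    rw [expo_of_lt hlt, Complex.ofReal_re]; simpa using hlt
  rw [hyx μ hμc, hDx μ hμc]
  refine hz_real μ hμc 1 hre1 ?_
  rw [hs, ← (hjost μ hμc 0 hre0 0).1, ← (hjost μ hμc 0 hre0 0).2]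
  have hconj : Solves (fun x => q x - (μ : ℂ)) (fun x => starRingEnd ℂ (y 0 x μ))
      (fun x => starRingEnd ℂ (D 0 x μ)) := (hF.solves μ hμc 0).conj fun x => by simp
  -- The bracket of the decaying solution with itself is constant and decays, hence vanishes; this
  -- is the condition at `0` that the growing solution inherits.
  have hW : ∀ x, y 0 x μ * starRingEnd ℂ (D 0 x μ) - D 0 x μ * starRingEnd ℂ (y 0 x μ) =
      y 0 0 μ * starRingEnd ℂ (D 0 0 μ) - D 0 0 μ * starRingEnd ℂ (y 0 0 μ) :=
    fun x => (hF.solves μ hμc 0).wronskian_eq hconj x 0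
  have hEr : starRingEnd ℂ (expo a 0 (μ : ℂ)) = expo a 0 μ := by
    rw [expo_of_lt hlt, Complex.conj_ofReal]
  have hcexp : ∀ x : ℝ, starRingEnd ℂ (Complex.exp (-expo a 0 (μ : ℂ) * x)) =
      Complex.exp (-expo a 0 (μ : ℂ) * x) := fun x => by
    rw [← Complex.exp_conj]; simp [hEr]
  have h1 := (Complex.continuous_conj.tendsto _).comp (hF.tendsto μ hμc 0)
  have h2 := (Complex.continuous_conj.tendsto _).comp (hF.tendsto' μ hμc 0)
  simp only [Function.comp_def, map_mul, hcexp, map_one, hEr] at h1 h2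
  have hlim := tendsto_wronskian (hF.tendsto μ hμc 0) (hF.tendsto' μ hμc 0) h1 h2
  simp only [hW, sub_self] at hlim
  exact sub_eq_zero.1 (eq_zero_of_tendsto_exp_mul hre0 hlim)

/-! ### Integrability hypotheses, spectral intervals and the final assembly -/

theorem integrableOn_comp_neg {g : ℝ → ℝ} {S : Set ℝ} (h : IntegrableOn g S volume) :
    IntegrableOn (fun x => g (-x)) (Neg.neg ⁻¹' S) volume :=
  ((Measure.measurePreserving_neg (volume : Measure ℝ)).integrableOn_comp_preimage
    (Homeomorph.neg ℝ).measurableEmbedding).2 h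

/-- The left hypothesis concerns the other limit, but on the compact piece `[X, 0]` the two shifts
of `q` differ by an integrable constant. -/
theorem integrableOn_shifted {q : ℝ → ℝ} {am ap : ℝ} (hq : AEMeasurable q volume)
    (hm : IntegrableOn (fun x => |q x - am|) (Iic 0) volume)
    (hp : IntegrableOn (fun x => |q x - ap|) (Ici 0) volume) (X : ℝ) :
    IntegrableOn (shifted q ap) (Ioi X) volume := by
  have hmeas : ∀ (c : ℝ) (S : Set ℝ), AEStronglyMeasurable (fun x => q x - c)
      (volume.restrict S) := fun c S => (hq.sub_const c).aestronglyMeasurable.restrict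
  have hm' : IntegrableOn (fun x => q x - am) (Iic 0) volume :=
    (integrable_norm_iff (hmeas am _)).1 hm
  have hp' : IntegrableOn (fun x => q x - ap) (Ici 0) volume :=
    (integrable_norm_iff (hmeas ap _)).1 hp
  have h1 : IntegrableOn (fun x => q x - ap) (Icc X 0) volume := by
    have h2 := (hm'.mono_set (Icc_subset_Iic_self (a := X))).add
      (integrableOn_const (C := am - ap) (measure_Icc_lt_top (a := X) (b := (0 : ℝ))).ne)
    exact h2.congr (ae_of_all _ fun x => by simp)
  have h3 : IntegrableOn (fun x => q x - ap) (Ioi X) volume := by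
    refine (h1.union hp').mono_set fun x hx => ?_
    rcases le_total x 0 with h | h
    · exact Or.inl ⟨le_of_lt hx, h⟩
    · exact Or.inr h
  exact h3.ofReal

/-- For `t ≥ 0` one has `t - X ≤ |X| + (1 + t)`, and for `X < t < 0` already `t - X ≤ |X|`. -/
theorem integrableOn_moment {q : ℝ → ℝ} {a : ℝ}
    (hV : ∀ X, IntegrableOn (shifted q a) (Ioi X) volume)
    (h : IntegrableOn (fun x => (1 + x) * |q x - a|) (Ici 0) volume) (X : ℝ) :
    IntegrableOn (fun t => (t - X) * ‖shifted q a t‖) (Ioi X) volume := by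
  have hn : ∀ t, ‖shifted q a t‖ = |q t - a| := fun t => by
    rw [shifted, Complex.norm_real, Real.norm_eq_abs]
  have h1 : IntegrableOn ((Ici 0).indicator fun x => (1 + x) * |q x - a|) (Ioi X) volume :=
    ((integrable_indicator_iff measurableSet_Ici).2 h).integrableOn
  refine Integrable.mono' (((hV X).norm.const_mul |X|).add h1) ?_ ?_
  · exact (Continuous.aestronglyMeasurable (by fun_prop)).mul (hV X).norm.aestronglyMeasurable
  · refine (ae_restrict_iff' measurableSet_Ioi).2 (ae_of_all _ fun t ht => ?_)
    have ht0 : 0 ≤ t - X := sub_nonneg.2 (le_of_lt ht)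
    have hX := neg_abs_le X
    rw [Real.norm_of_nonneg (by positivity), Pi.add_apply, hn]
    by_cases h0 : t ∈ Ici (0 : ℝ)
    · rw [indicator_of_mem h0]
      nlinarith [abs_nonneg (q t - a)]
    · rw [indicator_of_notMem h0]
      have : t < 0 := by simpa using h0
      nlinarith [abs_nonneg (q t - a)]

theorem r_of_lt {a μ : ℝ} (h : μ < a) : r a μ = 0 := by
  have : {t : ℝ | t ^ 2 + a = μ} = ∅ := by
    ext t
    simp only [mem_ofPred_eq, mem_empty_iff_false, iff_false]
    nlinarith [sq_nonneg t]
  rw [r, this]; simp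

theorem muInterval_zero_subset (am ap : ℝ) :
    muInterval am ap 0 ⊆ Iio ap ∧ muInterval am ap 0 ⊆ Iio am := by
  have h0 : ∀ μ ∈ muInterval am ap 0, μ < ap ∧ μ < am := fun μ hμ => by
    have : (μ : EReal) < ((min ap am : ℝ) : EReal) := hμ.2
    exact lt_min_iff.1 (EReal.coe_lt_coe_iff.1 this)
  exact ⟨fun μ hμ => (h0 μ hμ).1, fun μ hμ => (h0 μ hμ).2⟩

theorem muInterval_subset (am ap : ℝ) (k : Fin 3) :
    (muInterval am ap k ⊆ Iio ap ∨ muInterval am ap k ⊆ Ioi ap) ∧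
      (muInterval am ap k ⊆ Iio am ∨ muInterval am ap k ⊆ Ioi am) := by
  have h1 : ∀ μ ∈ muInterval am ap 1, min ap am < μ ∧ μ < max ap am := fun μ hμ => by
    have h2 : ((min ap am : ℝ) : EReal) < (μ : EReal) := hμ.1
    have h3 : (μ : EReal) < ((max ap am : ℝ) : EReal) := hμ.2
    exact ⟨EReal.coe_lt_coe_iff.1 h2, EReal.coe_lt_coe_iff.1 h3⟩
  have h2 : ∀ μ ∈ muInterval am ap 2, ap < μ ∧ am < μ := fun μ hμ => by
    have : ((max ap am : ℝ) : EReal) < (μ : EReal) := hμ.1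
    exact max_lt_iff.1 (EReal.coe_lt_coe_iff.1 this)
  obtain rfl | rfl | rfl : k = 0 ∨ k = 1 ∨ k = 2 := by revert k; decide
  · exact ⟨Or.inl (muInterval_zero_subset am ap).1, Or.inl (muInterval_zero_subset am ap).2⟩
  · rcases le_total ap am with h | h
    · simp only [min_eq_left h, max_eq_right h] at h1
      exact ⟨Or.inr fun μ hμ => (h1 μ hμ).1, Or.inl fun μ hμ => (h1 μ hμ).2⟩
    · simp only [min_eq_right h, max_eq_left h] at h1
      exact ⟨Or.inl fun μ hμ => (h1 μ hμ).2, Or.inr fun μ hμ => (h1 μ hμ).1⟩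
  · exact ⟨Or.inr fun μ hμ => (h2 μ hμ).1, Or.inr fun μ hμ => (h2 μ hμ).2⟩

theorem jointlyContinuous_empty {y : ℝ → ℂ → ℂ} : JointlyContinuous y ∅ := by
  simp [JointlyContinuous]

theorem contDiffInParam_empty {y : ℝ → ℂ → ℂ} : ContDiffInParam y ∅ := by
  simp [ContDiffInParam]

namespace ParamRegular

variable {a : ℝ} {i : Fin 2} {M : Prop} {y : Fin 2 → ℝ → ℂ → ℂ} {I : Set ℝ} {ρ : ℚ} {j : Fin 2}

theorem jointlyContinuous (h : ParamRegular a i M y) (hI : I ⊆ Iio a ∨ I ⊆ Ioi a)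
    (hρ : ∀ μ ∈ I, r a μ = ρ) (hj : ρ = 0 → j = i) :
    JointlyContinuous (y j) I ∧ JointlyContinuous (dx (y j)) I := by
  -- On an empty interval (`k = 1` with `a⁺ = a⁻`) nothing ties `ρ` to `r`, so this case is
  -- separate. Otherwise, below `a` one has `ρ = 0`, which leaves only the index `i`; above `a`
  -- every index is regular.
  rcases I.eq_empty_or_nonempty with rfl | ⟨μ, hμ⟩
  · exact ⟨jointlyContinuous_empty, jointlyContinuous_empty⟩
  rcases hI with hI | hI
  · rw [hj (by rw [← hρ μ hμ, r_of_lt (hI hμ)])]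
    exact ⟨h.cont_below.1.mono hI, h.cont_below.2.mono hI⟩
  · exact ⟨(h.cont_above j).1.mono hI, (h.cont_above j).2.mono hI⟩

theorem contDiffInParam (h : ParamRegular a i M y) (hM : M) (hI : I ⊆ Iio a ∨ I ⊆ Ioi a)
    (hρ : ∀ μ ∈ I, r a μ = ρ) (hj : ρ = 0 → j = i) :
    ContDiffInParam (y j) I ∧ ContDiffInParam (dx (y j)) I := by
  rcases I.eq_empty_or_nonempty with rfl | ⟨μ, hμ⟩
  · exact ⟨contDiffInParam_empty, contDiffInParam_empty⟩
  rcases hI with hI | hI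
  · rw [hj (by rw [← hρ μ hμ, r_of_lt (hI hμ)])]
    exact ⟨h.diff_below.1.mono hI, h.diff_below.2.mono hI⟩
  · exact ⟨(h.diff_above hM j).1.mono hI, (h.diff_above hM j).2.mono hI⟩

end ParamRegular

theorem eq_zero_of_succ_le {ρ : ℚ} {j : Fin 2} (h : ((j : ℕ) + 1 : ℚ) ≤ 1 + ρ) (hρ : ρ = 0) :
    j = 0 := by
  obtain rfl | rfl := Fin.exists_fin_two.1 ⟨j, rfl⟩
  · rfl
  · norm_num [hρ] at h

theorem eq_one_of_le_succ {ρ : ℚ} {j : Fin 2} (h : 2 - ρ ≤ ((j : ℕ) + 1 : ℚ)) (hρ : ρ = 0) :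
    j = 1 := by
  obtain rfl | rfl := Fin.exists_fin_two.1 ⟨j, rfl⟩
  · norm_num [hρ] at h
  · rfl

end SturmLiouville

end

theorem theorem1 (q : ℝ → ℝ) (am ap : ℝ) (hq : AEMeasurable q volume)
    (hm : IntegrableOn (fun x => |q x - am|) (Set.Iic 0) volume)
    (hp : IntegrableOn (fun x => |q x - ap|) (Set.Ici 0) volume) :
    ∃ yp ym : Fin 2 → ℝ → ℂ → ℂ,
      -- linearly independent solutions with the stated asymptotics
      (∀ μ : ℂ, μ ≠ (ap : ℂ) → IsJostPair q ap atTop yp μ) ∧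
      (∀ μ : ℂ, μ ≠ (am : ℂ) → IsJostPair q am atBot ym μ) ∧
      -- 1. brackets for real `μ`
      (∀ μ : ℝ, μ ≠ ap → μ ≠ am →
        BracketRelations ap yp (μ : ℂ) ∧ BracketRelations am ym (μ : ℂ)) ∧
      -- 2. joint continuity; `rp`, `rm` are the constant values of `r` on the `k`-th interval
      (∀ (k : Fin 3) (rp rm : ℚ),
        (∀ μ ∈ muInterval am ap k, r ap μ = rp ∧ r am μ = rm) →
        ∀ j : Fin 2,
          (((j : ℕ) + 1 : ℚ) ≤ 1 + rp →
            JointlyContinuous (yp j) (muInterval am ap k) ∧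
            JointlyContinuous (dx (yp j)) (muInterval am ap k)) ∧
          (2 - rm ≤ ((j : ℕ) + 1 : ℚ) →
            JointlyContinuous (ym j) (muInterval am ap k) ∧
            JointlyContinuous (dx (ym j)) (muInterval am ap k))) ∧
      -- 3. continuous differentiability in `μ` on the interval with `k = 0`
      (ContDiffInParam (yp 0) (muInterval am ap 0) ∧
        ContDiffInParam (dx (yp 0)) (muInterval am ap 0) ∧
        ContDiffInParam (ym 1) (muInterval am ap 0) ∧
        ContDiffInParam (dx (ym 1)) (muInterval am ap 0)) ∧
      -- 4. the intervals with `k = 1, 2`, under the first-moment condition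
      (IntegrableOn (fun x => (1 - x) * |q x - am|) (Set.Iic 0) volume →
        IntegrableOn (fun x => (1 + x) * |q x - ap|) (Set.Ici 0) volume →
        ∀ (k : Fin 3) (rp rm : ℚ), k ≠ 0 →
          (∀ μ ∈ muInterval am ap k, r ap μ = rp ∧ r am μ = rm) →
          ∀ j : Fin 2,
            (((j : ℕ) + 1 : ℚ) ≤ 1 + rp →
              ContDiffInParam (yp j) (muInterval am ap k) ∧
              ContDiffInParam (dx (yp j)) (muInterval am ap k)) ∧
            (2 - rm ≤ ((j : ℕ) + 1 : ℚ) →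
              ContDiffInParam (ym j) (muInterval am ap k) ∧
              ContDiffInParam (dx (ym j)) (muInterval am ap k))) := by

  have hVp := integrableOn_shifted hq hm hp
  have hqn : AEMeasurable (fun x => q (-x)) volume :=
    hq.comp_quasiMeasurePreserving
      (Measure.measurePreserving_neg (volume : Measure ℝ)).quasiMeasurePreserving
  -- The left end is the right end of the reflected potential, with the two limits exchanged.
  have hVm := integrableOn_shifted (q := fun x => q (-x)) (am := ap) (ap := am) hqn
    (by simpa using integrableOn_comp_neg hp) (by simpa using integrableOn_comp_neg hm)
  obtain ⟨yp, Dp, hFp, hbp, hrp⟩ := exists_jostFamily hVp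
  obtain ⟨u, D, hFu, hbu, hru⟩ := exists_jostFamily hVm
  have hFm := hFu.reflect
  have hrm := hru.reflect
  have h0 := muInterval_zero_subset am ap
  refine ⟨yp, fun j x μ => u (1 - j) (-x) μ, fun μ hμ => hFp.isJostPair hμ,
    fun μ hμ => hFm.isJostPair hμ, fun μ hp hm => ⟨hbp μ hp, (hbu μ hm).reflect⟩,
    fun k rp rm h j => ⟨fun hj => ?_, fun hj => ?_⟩,
    ⟨hrp.diff_below.1.mono h0.1, hrp.diff_below.2.mono h0.1, hrm.diff_below.1.mono h0.2,
      hrm.diff_below.2.mono h0.2⟩,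
    fun hMm hMp k rp rm _ h j => ⟨fun hj => ?_, fun hj => ?_⟩⟩
  · exact hrp.jointlyContinuous (muInterval_subset am ap k).1 (fun μ hμ => (h μ hμ).1)
      (eq_zero_of_succ_le hj)
  · exact hrm.jointlyContinuous (muInterval_subset am ap k).2 (fun μ hμ => (h μ hμ).2)
      (eq_one_of_le_succ hj)
  · exact hrp.contDiffInParam (integrableOn_moment hVp hMp) (muInterval_subset am ap k).1
      (fun μ hμ => (h μ hμ).1) (eq_zero_of_succ_le hj)
  · exact hrm.contDiffInParam (integrableOn_moment hVm
        (by simpa [sub_neg_eq_add] using integrableOn_comp_neg hMm))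
      (muInterval_subset am ap k).2 (fun μ hμ => (h μ hμ).2) (eq_one_of_le_succ hj)
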